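/- Let $d\ge 1$ and let $\rho:\mathbb R^d\to\mathbb R$ be smooth and compactly supported. For $s\in\mathbb R$ and $1\le p\le\infty$ let $\mathcal W^{s,p}(\mathbb R^d)$ be the space of tempered distributions $f$ with $\|f\|_{\mathcal W^{s,p}}:=\|\mathcal F^{-1}((1+|\cdot|^2)^{s/2}\mathcal Ff)\|_{L^p(\mathbb R^d)}<\infty$, where $\mathcal Ff(x)=\int f(y)e^{-\imath\langle x,y\rangle}dy$. Let $e^{t\Delta}$ denote the heat semigroup, i.e. the Fourier multiplier with symbol $e^{-t|\cdot|^2}$. Fix $\beta\in(0,1)$ and $2\le p<\infty$ with $\frac{d}{2p}<1+\frac{\beta}{2}$. For $T>0$ let $X(T):=\mathcal C([0,T];\mathcal W^{\beta,p}(\mathbb R^d))$ with the norm $\|v\|_{X(T)}:=\sup_{t\in[0,T]}\|v_t\|_{\mathcal W^{\beta,p}}$. For $\phi\in\mathcal W^{\beta,p}(\mathbb R^d)$ and $\Psi\in X(T)$ consider the mild equation $$v_t=e^{t\Delta}\phi+\int_0^t e^{(t-\tau)\Delta}(\rho^2v_\tau^2)\,d\tau+2\int_0^t e^{(t-\tau)\Delta}(\rho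 v_\tau\cdot\Psi_\tau)\,d\tau+\int_0^t e^{(t-\tau)\Delta}(\Psi_\tau^2)\,d\tau,\qquad t\in[0,T],\tag{$*$}$$ in which the products are pointwise products of functions and the integrals are integrals of tempered distributions (tested against Schwartz functions). Theorem. For every $\phi\in\mathcal W^{\beta,p}(\mathbb R^d)$ and every bound $M$ there are $T_0>0$ and $L\ge 0$ such that, for every $T\in(0,T_0]$: (i) for every $\Psi\in X(T)$ with $\|\Psi\|_{X(T)}\le M$, equation $(*)$ has a unique solution $v$ in $X(T)$; (ii) if $\Psi_1,\Psi_2\in X(T)$ satisfy $\|\Psi_i\|_{X(T)}\le M$ and $v_1,v_2\in X(T)$ are the solutions of $(*)$ associated with $\Psi_1,\Psi_2$ (with the same $\phi$), then $\|v_1-v_2\|_{X(T)}\le L\,\|\Psi_1-\Psi_2\|_{X(T)}$. -/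

import Mathlib

open MeasureTheory Set
open scoped SchwartzMap ENNReal ContDiff

noncomputable section

namespace QuadraticHeat

/-- The Euclidean space `ℝ^d`. -/
abbrev Sp (d : ℕ) : Type := EuclideanSpace ℝ (Fin d)

/-- The symbol `(1 + |ζ|²)^{s/2}`, at the angular frequency `ζ = 2πξ`: Mathlib's Fourier transform
is `∫ f(y) e^{-2πi⟨y,ξ⟩} dy`, so that the multiplier with symbol `m(ζ)` for the convention
`∫ f(y) e^{-i⟨y,ζ⟩} dy` is the multiplier with symbol `m(2πξ)` for Mathlib's convention. -/
def besselSymbol (d : ℕ) (s : ℝ) (ξ : Sp d) : ℂ :=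
  (((1 + ‖(2 * Real.pi) • ξ‖ ^ 2) ^ (s / 2) : ℝ) : ℂ)

theorem besselSymbol_hasTemperateGrowth (d : ℕ) (s : ℝ) :
    (besselSymbol d s).HasTemperateGrowth := by
  have h1 := Function.hasTemperateGrowth_one_add_norm_sq_rpow (Sp d) (s / 2)
  have h2 : (fun ξ : Sp d => (2 * Real.pi) • ξ).HasTemperateGrowth := by fun_prop
  exact Function.Complex.hasTemperateGrowth_ofReal.comp (h1.comp h2)

/-- The operator `(1 - Δ)^{s/2} = 𝓕⁻¹ (1 + |·|²)^{s/2} 𝓕` on tempered distributions. -/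
def bessel (d : ℕ) (s : ℝ) : 𝓢'(Sp d, ℂ) →L[ℂ] 𝓢'(Sp d, ℂ) :=
  TemperedDistribution.fourierMultiplierCLM ℂ (besselSymbol d s)

theorem bessel_injective (d : ℕ) (s : ℝ) : Function.Injective (bessel d s) := by
  have h : Function.LeftInverse (bessel d (-s)) (bessel d s) := by
    intro f
    rw [bessel, bessel, TemperedDistribution.fourierMultiplierCLM_fourierMultiplierCLM_apply
      (besselSymbol_hasTemperateGrowth d s) (besselSymbol_hasTemperateGrowth d (-s))]
    have : besselSymbol d s * besselSymbol d (-s) = fun _ => 1 := by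
      funext ξ
      simp only [besselSymbol, Pi.mul_apply]
      rw [← Complex.ofReal_mul, ← Real.rpow_add (by positivity)]
      simp [neg_div]
    rw [this]
    simp
  exact h.injective

/-- The embedding of `L^p(ℝ^d)` into the tempered distributions. -/
def lpEmbed (d : ℕ) (p : ℝ≥0∞) [Fact (1 ≤ p)] :
    Lp ℂ p (volume : Measure (Sp d)) →L[ℂ] 𝓢'(Sp d, ℂ) :=
  Lp.toTemperedDistributionCLM ℂ volume p

theorem lpEmbed_injective (d : ℕ) (p : ℝ≥0∞) [Fact (1 ≤ p)] :
    Function.Injective (lpEmbed d p) :=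
  LinearMap.ker_eq_bot.mp (Lp.ker_toTemperedDistributionCLM_eq_bot (p := p))

/-- The tempered distributions `f` such that `(1 - Δ)^{s/2} f` is an `L^p` function. -/
def sobolevSubmodule (d : ℕ) (s : ℝ) (p : ℝ≥0∞) [Fact (1 ≤ p)] : Submodule ℂ 𝓢'(Sp d, ℂ) :=
  (LinearMap.range (lpEmbed d p : Lp ℂ p (volume : Measure (Sp d)) →ₗ[ℂ] 𝓢'(Sp d, ℂ))).comap
    (bessel d s : 𝓢'(Sp d, ℂ) →ₗ[ℂ] 𝓢'(Sp d, ℂ))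

/-- The Sobolev space `W^{s,p}(ℝ^d)`. -/
def SobolevSpace (d : ℕ) (s : ℝ) (p : ℝ≥0∞) [Fact (1 ≤ p)] : Type :=
  sobolevSubmodule d s p

namespace SobolevSpace

variable {d : ℕ} {s : ℝ} {p : ℝ≥0∞} [Fact (1 ≤ p)]

instance : AddCommGroup (SobolevSpace d s p) :=
  inferInstanceAs (AddCommGroup (sobolevSubmodule d s p))

instance : Module ℂ (SobolevSpace d s p) :=
  inferInstanceAs (Module ℂ (sobolevSubmodule d s p))

/-- An element of `W^{s,p}(ℝ^d)` as a tempered distribution. -/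
def toDistribution : SobolevSpace d s p →ₗ[ℂ] 𝓢'(Sp d, ℂ) :=
  (sobolevSubmodule d s p).subtype

/-- The map sending `f` to the `L^p` function `(1 - Δ)^{s/2} f`. -/
def toLp : SobolevSpace d s p →ₗ[ℂ] Lp ℂ p (volume : Measure (Sp d)) :=
  (LinearEquiv.ofInjective
      (lpEmbed d p : Lp ℂ p (volume : Measure (Sp d)) →ₗ[ℂ] 𝓢'(Sp d, ℂ))
      (lpEmbed_injective d p)).symm.toLinearMap ∘ₗ
    ((bessel d s : 𝓢'(Sp d, ℂ) →ₗ[ℂ] 𝓢'(Sp d, ℂ)) ∘ₗ toDistribution).codRestrict _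
      (fun f => f.2)

theorem lpEmbed_toLp (f : SobolevSpace d s p) :
    lpEmbed d p (toLp f) = bessel d s (toDistribution f) :=
  congrArg Subtype.val ((LinearEquiv.ofInjective
      (lpEmbed d p : Lp ℂ p (volume : Measure (Sp d)) →ₗ[ℂ] 𝓢'(Sp d, ℂ))
      (lpEmbed_injective d p)).apply_symm_apply ⟨bessel d s (toDistribution f), f.2⟩)

theorem toLp_injective : Function.Injective (toLp : SobolevSpace d s p →ₗ[ℂ] _) := by
  intro f g h
  apply Subtype.ext
  apply bessel_injective d s
  exact (lpEmbed_toLp f).symm.trans ((congrArg (lpEmbed d p) h).trans (lpEmbed_toLp g))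

/-- The norm of `W^{s,p}(ℝ^d)` is `‖(1 - Δ)^{s/2} f‖_{L^p}`. -/
instance : NormedAddCommGroup (SobolevSpace d s p) :=
  NormedAddCommGroup.induced (SobolevSpace d s p) (Lp ℂ p (volume : Measure (Sp d)))
    toLp toLp_injective

instance : NormedSpace ℂ (SobolevSpace d s p) :=
  NormedSpace.induced ℂ (SobolevSpace d s p) (Lp ℂ p (volume : Measure (Sp d))) toLp

theorem norm_def (f : SobolevSpace d s p) : ‖f‖ = ‖toLp f‖ := rfl

end SobolevSpace

/-- The space `X(T) = C([0,T]; W^{s,p}(ℝ^d))`, with the supremum norm in time. -/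
abbrev X (d : ℕ) (s : ℝ) (p : ℝ≥0∞) [Fact (1 ≤ p)] (T : ℝ) : Type :=
  C(Icc (0 : ℝ) T, SobolevSpace d s p)

/-- The symbol `e^{-t|ζ|²}` of the heat semigroup at the angular frequency `ζ = 2πξ`. -/
def heatSymbol (d : ℕ) (t : ℝ) (ξ : Sp d) : ℂ :=
  ((Real.exp (-t * ‖(2 * Real.pi) • ξ‖ ^ 2) : ℝ) : ℂ)

theorem heatSymbol_hasTemperateGrowth (d : ℕ) {t : ℝ} (ht : 0 ≤ t) :
    (heatSymbol d t).HasTemperateGrowth := by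
  have h2 : (fun ξ : Sp d => ‖(2 * Real.pi) • ξ‖ ^ 2).HasTemperateGrowth :=
    (Function.hasTemperateGrowth_norm_sq (Sp d)).comp
      (f := fun ξ : Sp d => (2 * Real.pi) • ξ) (by fun_prop)
  have hc : ContDiff ℝ ∞ (fun y : ℝ => Real.exp (-t * y)) := by fun_prop
  have h3 : ((fun y : ℝ => Real.exp (-t * y)) ∘
      fun ξ : Sp d => ‖(2 * Real.pi) • ξ‖ ^ 2).HasTemperateGrowth := by
    refine Function.HasTemperateGrowth.comp' (t := Ici (0 : ℝ)) ?_ (uniqueDiffOn_Ici 0)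
      hc.contDiffOn ?_ h2
    · rintro - ⟨y, rfl⟩
      exact mem_Ici.mpr (by positivity)
    · intro N
      refine ⟨0, ∑ k ∈ Finset.range (N + 1), t ^ k, by positivity, fun n hn x hx => ?_⟩
      have hx' : (0 : ℝ) ≤ x := hx
      rw [norm_iteratedFDerivWithin_eq_norm_iteratedDerivWithin,
        iteratedDerivWithin_eq_iteratedDeriv (uniqueDiffOn_Ici 0)
          ((hc.of_le (by exact_mod_cast (le_top : (n : ℕ∞) ≤ ⊤))).contDiffAt) hx, iteratedDeriv_exp_const_mul]
      simp only [norm_mul, norm_pow, norm_neg, Real.norm_eq_abs, abs_of_nonneg ht, Real.abs_exp,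
        pow_zero, mul_one]
      calc t ^ n * Real.exp (-t * x) ≤ t ^ n * 1 := by
            gcongr
            rw [Real.exp_le_one_iff]
            nlinarith
        _ = t ^ n := mul_one _
        _ ≤ _ := Finset.single_le_sum (f := fun k => t ^ k) (fun _ _ => by positivity)
            (Finset.mem_range.mpr (by omega))
  exact Function.Complex.hasTemperateGrowth_ofReal.comp h3

/-- The heat semigroup `e^{tΔ}` on tempered distributions, for `t ≥ 0`. -/
def heat (d : ℕ) (t : ℝ) : 𝓢'(Sp d, ℂ) →L[ℂ] 𝓢'(Sp d, ℂ) :=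
  TemperedDistribution.fourierMultiplierCLM ℂ (heatSymbol d t)

/-- The tempered distribution `f` is the function `g`: for every Schwartz function `η`,
`η g` is integrable and `⟨f, η⟩ = ∫ η g`. -/
def IsFunction {d : ℕ} (f : 𝓢'(Sp d, ℂ)) (g : Sp d → ℂ) : Prop :=
  ∀ η : 𝓢(Sp d, ℂ), Integrable (fun x => η x * g x) ∧ f η = ∫ x, η x * g x

/-- `D = ∫_0^t e^{(t-τ)Δ} N_τ dτ`, as an integral of tempered distributions: for every Schwartz
function `η`, the function `τ ↦ ⟨e^{(t-τ)Δ} N_τ, η⟩` is integrable on `[0,t]` and its integral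
is `⟨D, η⟩`. -/
def IsDuhamel {d : ℕ} (N : ℝ → 𝓢'(Sp d, ℂ)) (t : ℝ) (D : 𝓢'(Sp d, ℂ)) : Prop :=
  ∀ η : 𝓢(Sp d, ℂ), IntervalIntegrable (fun τ => heat d (t - τ) (N τ) η) volume 0 t ∧
    D η = ∫ τ in (0 : ℝ)..t, heat d (t - τ) (N τ) η

/-- `v` solves, for all `t ∈ [0,T]`, the mild equation
`v_t = e^{tΔ}φ + ∫_0^t e^{(t-τ)Δ}(ρ² v_τ²) dτ + 2 ∫_0^t e^{(t-τ)Δ}(ρ v_τ · Ψ_τ) dτ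
  + ∫_0^t e^{(t-τ)Δ}(Ψ_τ²) dτ`.
Here `w τ` and `ψ τ` are the functions `v_τ` and `Ψ_τ`, and `N₁ τ`, `N₂ τ`, `N₃ τ` are the
tempered distributions `ρ² v_τ²`, `ρ v_τ · Ψ_τ`, `Ψ_τ²`; only times `τ ∈ [0,T]` matter. -/
def IsMildSolution {d : ℕ} {s : ℝ} {p : ℝ≥0∞} [Fact (1 ≤ p)] {T : ℝ} (ρ : Sp d → ℝ)
    (φ : SobolevSpace d s p) (Ψ v : X d s p T) : Prop :=
  ∃ (w ψ : ℝ → Sp d → ℂ) (N₁ N₂ N₃ : ℝ → 𝓢'(Sp d, ℂ)),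
    (∀ τ : Icc (0 : ℝ) T,
      IsFunction (v τ).toDistribution (w τ) ∧
      IsFunction (Ψ τ).toDistribution (ψ τ) ∧
      IsFunction (N₁ τ) (fun x => (ρ x : ℂ) ^ 2 * w τ x ^ 2) ∧
      IsFunction (N₂ τ) (fun x => (ρ x : ℂ) * w τ x * ψ τ x) ∧
      IsFunction (N₃ τ) (fun x => ψ τ x ^ 2)) ∧
    ∀ t : Icc (0 : ℝ) T, ∃ D₁ D₂ D₃ : 𝓢'(Sp d, ℂ),
      IsDuhamel N₁ t D₁ ∧ IsDuhamel N₂ t D₂ ∧ IsDuhamel N₃ t D₃ ∧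
      (v t).toDistribution = heat d t φ.toDistribution + D₁ + (2 : ℂ) • D₂ + D₃

end QuadraticHeat

end

/-! ### Integral inequalities: Young and Minkowski -/

noncomputable section

namespace QuadraticHeat

/-! The equation is solved by a contraction argument in which every product is formed in a Lebesgue
space. With x = 1/q, embed W^{β,p} in L^q; Hölder puts the square (ρv + Ψ)² in L^m with 1/m = 2x,
and e^{tΔ} brings L^m back to W^{β,p} with norm at most C t^{-γ}, γ = β/2 + (d/2)(2x - 1/p), for t ≤
1. The embedding needs d(1/p - x) < β, and an integrable singularity needs γ < 1; these two
conditions on x are compatible exactly when d/(2p) < 1 + β/2 (`exists_exponent`). Multiplication by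
ρ acts on L^q, so no fractional Leibniz rule enters.

Since γ < 1, the Duhamel operator gains a factor T^{1-γ}. For small T the fixed-point map is a
1/2-contraction of the ball of radius ‖φ‖ + 1. A first-exit argument confines every solution to that
ball, so uniqueness holds in the whole of X(T), and the difference estimate gives the Lipschitz
bound with L = 1 (`exists_time_wellPosed`).

The linear estimates use only Young's inequality for superpositions of heat kernels, with no
singular integral theory. Negative powers of 1 - Δ come from the Gamma integral
(`exists_multBound_bessel_neg`). Positive powers come from λ^a = c⁻¹ ∫ s^{-1-a}(1 - e^{-λs}) ds and
an L¹ bound on K_t - e^{-s}K_{t+s} (`exists_multBound_heat_mul_bessel`).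

The distributional equation reduces to the fixed-point equation (`isMildSolution_iff`): a
distribution has at most one function representative up to null sets, and the weak Duhamel integral
is the image of a Bochner integral in W^{β,p}. -/

/-- Young's convolution inequality for nonnegative functions. -/
theorem lintegral_convolution_rpow_le {d : ℕ} {p q r : ℝ} (hp : 0 < p) (hr : 0 < r)
    (hpq : p ≤ q) (hrq : r ≤ q) (h : 1 + 1 / q = 1 / r + 1 / p) {K f : Sp d → ℝ≥0∞}
    (hK : Measurable K) (hf : Measurable f) :
    ∫⁻ x, (∫⁻ y, K (x - y) * f y) ^ q ≤
      (∫⁻ x, K x ^ r) ^ (q / r) * (∫⁻ x, f x ^ p) ^ (q / p) := by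
  have hq : 0 < q := hp.trans_le hpq
  set A := ∫⁻ x, K x ^ r
  set B := ∫⁻ x, f x ^ p
  have e1 : 0 ≤ 1 / r - 1 / q := sub_nonneg.2 (one_div_le_one_div_of_le hr hrq)
  have e2 : 0 ≤ 1 / p - 1 / q := sub_nonneg.2 (one_div_le_one_div_of_le hp hpq)
  have e0 : 0 ≤ 1 / q := by positivity
  have hA : ∀ x, ∫⁻ y, K (x - y) ^ r = A := fun x =>
    lintegral_sub_left_eq_self (fun y => K y ^ r) x
  have key : ∀ x, (∫⁻ y, K (x - y) * f y) ^ q ≤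
      (∫⁻ y, K (x - y) ^ r * f y ^ p) * (A ^ (q / r - 1) * B ^ (q / p - 1)) := by
    intro x
    -- Three-factor Hölder for K f = (K^r f^p)^{1/q} (K^r)^{1/r-1/q} (f^p)^{1/p-1/q}; the exponents
    -- sum to 1 by `h`.
    have h1 := ENNReal.lintegral_prod_norm_pow_le (μ := (volume : Measure (Sp d))) Finset.univ
      (f := ![fun y => K (x - y) ^ r * f y ^ p, fun y => K (x - y) ^ r, fun y => f y ^ p])
      (p := ![1 / q, 1 / r - 1 / q, 1 / p - 1 / q])
      (by
        intro i _
        fin_cases i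
        · exact (((hK.comp (measurable_const.sub measurable_id)).pow_const r).mul
            (hf.pow_const p)).aemeasurable
        · exact ((hK.comp (measurable_const.sub measurable_id)).pow_const r).aemeasurable
        · exact (hf.pow_const p).aemeasurable)
      (by simp [Fin.sum_univ_three]; simp at h; linarith)
      (by
        intro i _
        fin_cases i
        exacts [e0, e1, e2])
    simp only [Fin.prod_univ_three, Matrix.cons_val_zero, Matrix.cons_val_one,
      Matrix.cons_val] at h1
    have h2 : ∀ y, (K (x - y) ^ r * f y ^ p) ^ (1 / q) * (K (x - y) ^ r) ^ (1 / r - 1 / q) *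
        (f y ^ p) ^ (1 / p - 1 / q) = K (x - y) * f y := by
      intro y
      rw [ENNReal.mul_rpow_of_nonneg _ _ e0]
      simp only [← ENNReal.rpow_mul]
      rw [mul_right_comm, mul_assoc (K (x - y) ^ (r * (1 / q))), mul_assoc, mul_comm _ (K _ ^ _),
        ← mul_assoc, ← ENNReal.rpow_add_of_nonneg _ _ (by positivity) (by positivity),
        ← ENNReal.rpow_add_of_nonneg _ _ (by positivity) (by positivity)]
      have : r * (1 / q) + r * (1 / r - 1 / q) = 1 := by field_simp; ring
      rw [this]
      have : p * (1 / q) + p * (1 / p - 1 / q) = 1 := by field_simp; ring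
      rw [this, ENNReal.rpow_one, ENNReal.rpow_one]
    simp only [h2, hA] at h1
    calc _ ≤ _ := ENNReal.rpow_le_rpow h1 hq.le
      _ = _ := by
        rw [ENNReal.mul_rpow_of_nonneg _ _ hq.le, ENNReal.mul_rpow_of_nonneg _ _ hq.le]
        simp only [← ENNReal.rpow_mul]
        rw [mul_assoc, show 1 / q * q = 1 by field_simp, ENNReal.rpow_one,
          show (1 / r - 1 / q) * q = q / r - 1 by field_simp,
          show (1 / p - 1 / q) * q = q / p - 1 by field_simp]
  have hm : Measurable fun z : Sp d × Sp d => K (z.1 - z.2) ^ r * f z.2 ^ p :=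
    ((hK.comp (measurable_fst.sub measurable_snd)).pow_const r).mul
      ((hf.comp measurable_snd).pow_const p)
  have f1 : 0 ≤ q / r - 1 := sub_nonneg.2 ((one_le_div hr).2 hrq)
  have f2 : 0 ≤ q / p - 1 := sub_nonneg.2 ((one_le_div hp).2 hpq)
  calc _ ≤ ∫⁻ x, (∫⁻ y, K (x - y) ^ r * f y ^ p) * (A ^ (q / r - 1) * B ^ (q / p - 1)) :=
        lintegral_mono key
    _ = (∫⁻ x, ∫⁻ y, K (x - y) ^ r * f y ^ p) * (A ^ (q / r - 1) * B ^ (q / p - 1)) :=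
        lintegral_mul_const _ hm.lintegral_prod_right
    _ = A * B * (A ^ (q / r - 1) * B ^ (q / p - 1)) := by
        congr 1
        rw [lintegral_lintegral_swap hm.aemeasurable]
        have : ∀ y, ∫⁻ x, K (x - y) ^ r * f y ^ p = A * f y ^ p := by
          intro y
          have hKy : Measurable fun x => K (x - y) ^ r :=
            (hK.comp (measurable_id.sub measurable_const)).pow_const r
          rw [lintegral_mul_const _ hKy]
          congr 1
          exact lintegral_sub_right_eq_self (fun y => K y ^ r) y
        simp only [this]
        exact lintegral_const_mul _ (hf.pow_const p)
    _ = A * A ^ (q / r - 1) * (B * B ^ (q / p - 1)) := by ring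
    _ = _ := by
        nth_rw 1 [← ENNReal.rpow_one A]
        nth_rw 1 [← ENNReal.rpow_one B]
        rw [← ENNReal.rpow_add_of_nonneg _ _ zero_le_one f1,
          ← ENNReal.rpow_add_of_nonneg _ _ zero_le_one f2]
        simp

/-- Minkowski's integral inequality, for a majorant of the inner norms. -/
theorem lintegral_lintegral_rpow_le {α β : Type*} [MeasurableSpace α] [MeasurableSpace β]
    {μ : Measure α} {ν : Measure β} [SFinite μ] [SFinite ν] {r : ℝ} (hr : 1 ≤ r)
    {F : β → α → ℝ≥0∞} (hF : Measurable (Function.uncurry F)) {w : β → ℝ≥0∞} (hw : Measurable w)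
    (hw0 : ∀ᵐ s ∂ν, w s ≠ 0) (hwt : ∀ᵐ s ∂ν, w s ≠ ⊤)
    (h : ∀ᵐ s ∂ν, ∫⁻ x, F s x ^ r ∂μ ≤ w s ^ r) :
    ∫⁻ x, (∫⁻ s, F s x ∂ν) ^ r ∂μ ≤ (∫⁻ s, w s ∂ν) ^ r := by
  have hr0 : 0 < r := by linarith
  have hi : 0 ≤ 1 - 1 / r := sub_nonneg.2 ((div_le_one hr0).2 hr)
  set W := ∫⁻ s, w s ∂ν
  have hFx : ∀ x, Measurable fun s => F s x := fun x => hF.comp (measurable_id.prodMk measurable_const)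
  -- Hölder applied to F = w^{1-1/r} (F^r w^{1-r})^{1/r}. Knowing a majorant w of the inner norms,
  -- Tonelli then finishes without duality.
  have key : ∀ x, (∫⁻ s, F s x ∂ν) ^ r ≤ W ^ (r - 1) * ∫⁻ s, F s x ^ r * w s ^ (1 - r) ∂ν := by
    intro x
    have h1 := ENNReal.lintegral_mul_norm_pow_le (μ := ν) (f := w)
      (g := fun s => F s x ^ r * w s ^ (1 - r)) hw.aemeasurable
      (((hFx x).pow_const r).mul (hw.pow_const _)).aemeasurable hi
      (show 0 ≤ 1 / r by positivity) (by ring)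
    have h2 : ∀ᵐ s ∂ν, w s ^ (1 - 1 / r) * (F s x ^ r * w s ^ (1 - r)) ^ (1 / r) = F s x := by
      filter_upwards [hw0, hwt] with s h0 ht
      rw [ENNReal.mul_rpow_of_nonneg _ _ (by positivity), ← ENNReal.rpow_mul, ← ENNReal.rpow_mul,
        mul_left_comm, ← ENNReal.rpow_add _ _ h0 ht,
        show r * (1 / r) = 1 by field_simp,
        show 1 - 1 / r + (1 - r) * (1 / r) = 0 by field_simp; ring]
      simp
    rw [lintegral_congr_ae h2] at h1
    calc _ ≤ _ := ENNReal.rpow_le_rpow h1 hr0.le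
      _ = _ := by
        rw [ENNReal.mul_rpow_of_nonneg _ _ hr0.le, ← ENNReal.rpow_mul, ← ENNReal.rpow_mul,
          show 1 / r * r = 1 by field_simp, ENNReal.rpow_one,
          show (1 - 1 / r) * r = r - 1 by field_simp]
  have hm : Measurable (Function.uncurry fun x s => F s x ^ r * w s ^ (1 - r)) :=
    ((hF.comp measurable_swap).pow_const r).mul ((hw.comp measurable_snd).pow_const _)
  calc _ ≤ ∫⁻ x, W ^ (r - 1) * ∫⁻ s, F s x ^ r * w s ^ (1 - r) ∂ν ∂μ := lintegral_mono key
    _ = W ^ (r - 1) * ∫⁻ x, ∫⁻ s, F s x ^ r * w s ^ (1 - r) ∂ν ∂μ :=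
        lintegral_const_mul _ hm.lintegral_prod_right
    _ = W ^ (r - 1) * ∫⁻ s, ∫⁻ x, F s x ^ r * w s ^ (1 - r) ∂μ ∂ν := by
        rw [lintegral_lintegral_swap hm.aemeasurable]
    _ ≤ W ^ (r - 1) * ∫⁻ s, w s ∂ν := by
        refine mul_le_mul_right (lintegral_mono_ae ?_) _
        filter_upwards [hw0, hwt, h] with s h0 ht hs
        have hFs : Measurable fun x => F s x ^ r :=
          (hF.comp (measurable_const.prodMk measurable_id)).pow_const r
        rw [lintegral_mul_const _ hFs]
        calc _ ≤ w s ^ r * w s ^ (1 - r) := by gcongr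
          _ = w s := by rw [← ENNReal.rpow_add _ _ h0 ht]; simp
    _ = W ^ r := by
        nth_rw 2 [show r = r - 1 + 1 by ring]
        rw [ENNReal.rpow_add_of_nonneg _ _ (by linarith) zero_le_one, ENNReal.rpow_one]

end QuadraticHeat

end

/-! ### Fourier multipliers from L^p to L^q given by integrable kernels -/

noncomputable section

namespace QuadraticHeat

open FourierTransform TemperedDistribution

theorem lpEmbed_apply {d : ℕ} {p : ℝ≥0∞} [Fact (1 ≤ p)] (f : Lp ℂ p (volume : Measure (Sp d)))
    (η : 𝓢(Sp d, ℂ)) : lpEmbed d p f η = ∫ x, η x * f x := by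
  simp [lpEmbed]

theorem lpEmbed_isFunction {d : ℕ} {p : ℝ≥0∞} [Fact (1 ≤ p)]
    (f : Lp ℂ p (volume : Measure (Sp d))) : IsFunction (lpEmbed d p f) f := by
  intro η
  refine ⟨?_, lpEmbed_apply f η⟩
  have := ENNReal.HolderConjugate.inv_one_sub_inv' (Fact.out : 1 ≤ p)
  exact (η.memLp (1 - p⁻¹)⁻¹ volume).integrable_mul (Lp.memLp f)

/-- The Fourier multiplier with symbol `σ` maps `L^p` to `L^q` with norm at most `A`. -/
def MultBound {d : ℕ} (σ : Sp d → ℂ) (p q : ℝ≥0∞) [Fact (1 ≤ p)] [Fact (1 ≤ q)] (A : ℝ) : Prop :=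
  ∀ f : Lp ℂ p (volume : Measure (Sp d)), ∃ g : Lp ℂ q (volume : Measure (Sp d)),
    lpEmbed d q g = fourierMultiplierCLM ℂ σ (lpEmbed d p f) ∧ ‖g‖ ≤ A * ‖f‖

theorem MultBound.comp {d : ℕ} {σ₁ σ₂ : Sp d → ℂ} {p q r : ℝ≥0∞} [Fact (1 ≤ p)] [Fact (1 ≤ q)]
    [Fact (1 ≤ r)] {A₁ A₂ : ℝ} (hσ₁ : σ₁.HasTemperateGrowth) (hσ₂ : σ₂.HasTemperateGrowth)
    (hA : 0 ≤ A₂) (h₁ : MultBound σ₁ p q A₁) (h₂ : MultBound σ₂ q r A₂) :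
    MultBound (σ₁ * σ₂) p r (A₂ * A₁) := by
  intro f
  obtain ⟨g, hg, hgn⟩ := h₁ f
  obtain ⟨u, hu, hun⟩ := h₂ g
  refine ⟨u, ?_, ?_⟩
  · rw [hu, hg, fourierMultiplierCLM_fourierMultiplierCLM_apply hσ₁ hσ₂]
  · calc ‖u‖ ≤ A₂ * ‖g‖ := hun
      _ ≤ A₂ * (A₁ * ‖f‖) := by gcongr
      _ = _ := by ring

theorem MultBound.mono {d : ℕ} {σ : Sp d → ℂ} {p q : ℝ≥0∞} [Fact (1 ≤ p)] [Fact (1 ≤ q)]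
    {A B : ℝ} (h : MultBound σ p q A) (hAB : A ≤ B) : MultBound σ p q B := by
  intro f
  obtain ⟨g, hg, hgn⟩ := h f
  exact ⟨g, hg, hgn.trans (by gcongr)⟩

theorem MultBound.const_smul {d : ℕ} {σ : Sp d → ℂ} {p q : ℝ≥0∞} [Fact (1 ≤ p)] [Fact (1 ≤ q)]
    {A : ℝ} (hσ : σ.HasTemperateGrowth) (h : MultBound σ p q A) (c : ℂ) :
    MultBound (c • σ) p q (‖c‖ * A) := by
  intro f
  obtain ⟨g, hg, hgn⟩ := h f
  refine ⟨c • g, ?_, ?_⟩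
  · rw [map_smul, hg, fourierMultiplierCLM_smul hσ]
    rfl
  · rw [norm_smul, mul_assoc]
    gcongr

/-- A bounded Fourier multiplier as a continuous linear map. -/
theorem MultBound.exists_clm {d : ℕ} {σ : Sp d → ℂ} {p q : ℝ≥0∞} [Fact (1 ≤ p)] [Fact (1 ≤ q)]
    {A : ℝ} (hA : 0 ≤ A) (h : MultBound σ p q A) :
    ∃ S : Lp ℂ p (volume : Measure (Sp d)) →L[ℂ] Lp ℂ q (volume : Measure (Sp d)),
      (∀ f, lpEmbed d q (S f) = fourierMultiplierCLM ℂ σ (lpEmbed d p f)) ∧ ‖S‖ ≤ A := by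
  -- The chosen image is automatically linear in f, because `lpEmbed` is injective.
  choose g hg hgn using h
  refine ⟨LinearMap.mkContinuous ⟨⟨g, fun f₁ f₂ => ?_⟩, fun c f => ?_⟩ A hgn, hg,
    LinearMap.mkContinuous_norm_le _ hA _⟩
  · apply lpEmbed_injective d q
    rw [hg, map_add, map_add, map_add, hg, hg]
  · apply lpEmbed_injective d q
    simp only [RingHom.id_apply]
    rw [hg, map_smul, map_smul, map_smul, hg]

/-- A multiplier whose symbol is the Fourier transform of an integrable function acts on test
functions as a convolution. -/
theorem fourier_smulLeftCLM_fourierInv_apply {d : ℕ} {σ k : Sp d → ℂ}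
    (hσ : σ.HasTemperateGrowth) (hk : Integrable k) (hkσ : 𝓕 k = σ) (η : 𝓢(Sp d, ℂ)) (y : Sp d) :
    (𝓕 (SchwartzMap.smulLeftCLM ℂ σ (𝓕⁻ η))) y = ∫ z, k z * η (z + y) := by
  set h := 𝓕⁻ η with hh
  have hη : ∀ x, η x = 𝓕 (h : Sp d → ℂ) x := by
    intro x
    rw [← SchwartzMap.fourier_coe, hh, fourier_fourierInv_eq]
  rw [SchwartzMap.fourier_coe, Real.fourier_eq]
  -- The Fourier transform is moved from k onto the modulated function e^{-2πi⟨v,y⟩} h(v), whose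
  -- transform is the translate η(· + y).
  have h1 := VectorFourier.integral_fourierIntegral_smul_eq_flip (L := innerₗ (Sp d))
    (μ := volume) (ν := volume) (f := k)
    (g := fun v => Real.fourierChar (-inner ℝ v y) • h v) Real.continuous_fourierChar
    continuous_inner hk ((VectorFourier.fourierIntegral_convergent_iff
      (L := innerₗ (Sp d)) Real.continuous_fourierChar continuous_inner y).2 h.integrable)
  calc _ = ∫ v, (𝓕 k v) • (Real.fourierChar (-inner ℝ v y) • h v) := by
        refine integral_congr_ae (ae_of_all _ fun v => ?_)
        simp only [SchwartzMap.smulLeftCLM_apply_apply hσ, hkσ]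
        rw [smul_comm]
    _ = _ := h1
    _ = _ := by
        refine integral_congr_ae (ae_of_all _ fun z => ?_)
        simp only [smul_eq_mul]
        congr 1
        rw [hη, Real.fourier_eq]
        change ∫ v, _ = _
        refine integral_congr_ae (ae_of_all _ fun v => ?_)
        simp only [smul_smul, LinearMap.flip_apply, innerₗ_apply_apply]
        congr 1
        rw [← AddChar.map_add_eq_mul, inner_add_right, real_inner_comm, neg_add]

/-- Young's inequality for the Fourier multiplier with an integrable kernel `k ∈ L^r`. -/
theorem multBound_of_kernel {d : ℕ} {σ k : Sp d → ℂ} {p q : ℝ≥0∞} [Fact (1 ≤ p)] [Fact (1 ≤ q)]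
    (hp : p ≠ ⊤) (hq : q ≠ ⊤) {r : ℝ} (hr : 0 < r) (hpq : p.toReal ≤ q.toReal)
    (hrq : r ≤ q.toReal) (h : 1 + 1 / q.toReal = 1 / r + 1 / p.toReal)
    (hσ : σ.HasTemperateGrowth) (hkm : Measurable k) (hk : Integrable k) (hkσ : 𝓕 k = σ) {A : ℝ}
    (hA : 0 ≤ A) (hkA : ∫⁻ x, ‖k x‖ₑ ^ r ≤ ENNReal.ofReal A ^ r) : MultBound σ p q A := by
  intro f
  have hp1 : (1 : ℝ≥0∞) ≤ p := Fact.out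
  have hq1 : (1 : ℝ≥0∞) ≤ q := Fact.out
  have hp0 : p ≠ 0 := (zero_lt_one.trans_le hp1).ne'
  have hq0 : q ≠ 0 := (zero_lt_one.trans_le hq1).ne'
  have hpr : 0 < p.toReal := ENNReal.toReal_pos hp0 hp
  have hqr : 0 < q.toReal := ENNReal.toReal_pos hq0 hq
  have hqr1 : 1 ≤ q.toReal := by
    rw [← ENNReal.toReal_one]
    exact ENNReal.toReal_mono hq hq1
  have hfm : Measurable f := (Lp.stronglyMeasurable f).measurable
  set F : Sp d → ℝ≥0∞ := fun x => ∫⁻ y, ‖k (x - y)‖ₑ * ‖f y‖ₑ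
  have hFm : Measurable F := by
    apply Measurable.lintegral_prod_right (f := fun x y => ‖k (x - y)‖ₑ * ‖f y‖ₑ)
    exact (hkm.comp (measurable_fst.sub measurable_snd)).enorm.mul (hfm.comp measurable_snd).enorm
  have hF : ∫⁻ x, F x ^ q.toReal ≤ (ENNReal.ofReal A * ‖f‖ₑ) ^ q.toReal := by
    refine (lintegral_convolution_rpow_le hpr hr hpq hrq h hkm.enorm hfm.enorm).trans ?_
    have h1 : (∫⁻ x, ‖k x‖ₑ ^ r) ^ (q.toReal / r) ≤ ENNReal.ofReal A ^ q.toReal := by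
      calc _ ≤ (ENNReal.ofReal A ^ r) ^ (q.toReal / r) :=
            ENNReal.rpow_le_rpow hkA (by positivity)
        _ = _ := by rw [← ENNReal.rpow_mul, mul_div_cancel₀ _ hr.ne']
    have h2 : (∫⁻ x, ‖f x‖ₑ ^ p.toReal) ^ (q.toReal / p.toReal) = ‖f‖ₑ ^ q.toReal := by
      rw [Lp.enorm_def, eLpNorm_eq_lintegral_rpow_enorm_toReal hp0 hp, ← ENNReal.rpow_mul]
      congr 1
      field_simp
    rw [h2, ENNReal.mul_rpow_of_nonneg _ _ hqr.le]
    gcongr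
  set g : Sp d → ℂ := fun x => ∫ y, k (x - y) * f y
  have hgm : StronglyMeasurable g := by
    apply StronglyMeasurable.integral_prod_right (f := fun x y => k (x - y) * f y)
    exact ((hkm.comp (measurable_fst.sub measurable_snd)).mul
      (hfm.comp measurable_snd)).stronglyMeasurable
  have hgF : ∀ x, ‖g x‖ₑ ≤ F x := by
    intro x
    refine (enorm_integral_le_lintegral_enorm _).trans (le_of_eq ?_)
    simp only [enorm_mul, F]
  have hgn : eLpNorm g q volume ≤ ENNReal.ofReal A * ‖f‖ₑ := by
    rw [eLpNorm_eq_lintegral_rpow_enorm_toReal hq0 hq, one_div, ENNReal.rpow_inv_le_iff hqr]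
    refine le_trans (lintegral_mono fun x => ?_) hF
    exact ENNReal.rpow_le_rpow (hgF x) hqr.le
  have hfin : ENNReal.ofReal A * ‖f‖ₑ < ⊤ := ENNReal.mul_lt_top ENNReal.ofReal_lt_top enorm_lt_top
  have hg : MemLp g q volume := ⟨hgm.aestronglyMeasurable, hgn.trans_lt hfin⟩
  refine ⟨hg.toLp g, ?_, ?_⟩
  · ext η
    rw [lpEmbed_apply, fourierMultiplierCLM_apply_apply, lpEmbed_apply]
    -- This justifies Fubini below. Splitting at F = 1 gives |η| F ≤ |η| + C F^q, which avoids the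
    -- dual exponent.
    have hηF : ∫⁻ x, ‖η x‖ₑ * F x < ⊤ := by
      obtain ⟨C, hC⟩ : ∃ C : ℝ, ∀ x, ‖η x‖ ≤ C := by
        obtain ⟨C, -, hC⟩ := η.decay 0 0
        exact ⟨C, fun x => by simpa using hC x⟩
      have hle : ∀ x, ‖η x‖ₑ * F x ≤ ‖η x‖ₑ + ENNReal.ofReal C * F x ^ q.toReal := by
        intro x
        rcases le_total (F x) 1 with hx | hx
        · exact le_add_right (mul_le_of_le_one_right' hx)
        · refine le_add_left (mul_le_mul' ?_ ?_)
          · rw [← ofReal_norm]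
            exact ENNReal.ofReal_le_ofReal (hC x)
          · nth_rw 1 [← ENNReal.rpow_one (F x)]
            exact ENNReal.rpow_le_rpow_of_exponent_le hx hqr1
      refine (lintegral_mono hle).trans_lt ?_
      rw [lintegral_add_left η.continuous.measurable.enorm,
        lintegral_const_mul _ (hFm.pow_const _)]
      refine ENNReal.add_lt_top.2 ⟨η.integrable.2, ENNReal.mul_lt_top ENNReal.ofReal_lt_top ?_⟩
      exact hF.trans_lt (ENNReal.rpow_lt_top_of_nonneg hqr.le hfin.ne)
    have hint : Integrable (Function.uncurry fun x y => η x * (k (x - y) * f y))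
        ((volume : Measure (Sp d)).prod volume) := by
      have hm : Measurable (Function.uncurry fun x y => η x * (k (x - y) * f y)) :=
        (η.continuous.measurable.comp measurable_fst).mul
          ((hkm.comp (measurable_fst.sub measurable_snd)).mul (hfm.comp measurable_snd))
      refine ⟨hm.aestronglyMeasurable, ?_⟩
      rw [HasFiniteIntegral, lintegral_prod _ hm.enorm.aemeasurable]
      refine lt_of_le_of_lt (lintegral_mono fun x => le_of_eq ?_) hηF
      simp only [Function.uncurry, enorm_mul, F]
      refine lintegral_const_mul _ ?_
      exact (hkm.comp (measurable_const.sub measurable_id)).enorm.mul hfm.enorm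
    calc ∫ x, η x * hg.toLp g x = ∫ x, ∫ y, η x * (k (x - y) * f y) := by
          refine integral_congr_ae ?_
          filter_upwards [hg.coeFn_toLp] with x hx
          rw [hx, integral_const_mul]
      _ = ∫ y, ∫ x, η x * (k (x - y) * f y) := integral_integral_swap hint
      _ = _ := by
          refine integral_congr_ae (ae_of_all _ fun y => ?_)
          simp only
          rw [fourier_smulLeftCLM_fourierInv_apply hσ hk hkσ, ← integral_mul_const,
            ← integral_sub_right_eq_self (fun x => k x * η (x + y) * f y) y]
          refine integral_congr_ae (ae_of_all _ fun x => ?_)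
          simp only [sub_add_cancel]
          ring
  · rw [Lp.norm_toLp]
    refine (ENNReal.toReal_mono hfin.ne hgn).trans (le_of_eq ?_)
    rw [ENNReal.toReal_mul, ENNReal.toReal_ofReal hA, toReal_enorm]

end QuadraticHeat

end

/-! ### The heat kernel: norms, Fourier transform, modulus of continuity in time -/

noncomputable section

namespace QuadraticHeat

open FourierTransform TemperedDistribution

/-- The heat kernel `(4πt)^{-d/2} e^{-|x|²/(4t)}`. -/
def heatKernel (d : ℕ) (t : ℝ) (x : Sp d) : ℝ :=
  (4 * Real.pi * t) ^ (-(d / 2 : ℝ)) * Real.exp (-(1 / (4 * t)) * ‖x‖ ^ 2)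

theorem measurable_heatKernel (d : ℕ) :
    Measurable fun z : ℝ × Sp d => heatKernel d z.1 z.2 := by
  unfold heatKernel
  fun_prop

theorem measurable_heatKernel_right (d : ℕ) (t : ℝ) : Measurable (heatKernel d t) :=
  (measurable_heatKernel d).comp measurable_prodMk_left

theorem heatKernel_nonneg (d : ℕ) {t : ℝ} (ht : 0 ≤ t) (x : Sp d) : 0 ≤ heatKernel d t x := by
  unfold heatKernel
  positivity

theorem heatKernel_le (d : ℕ) {t : ℝ} (ht : 0 < t) (x : Sp d) :
    heatKernel d t x ≤ (4 * Real.pi * t) ^ (-(d / 2 : ℝ)) := by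
  unfold heatKernel
  refine mul_le_of_le_one_right (by positivity) (Real.exp_le_one_iff.2 ?_)
  have : 0 ≤ 1 / (4 * t) * ‖x‖ ^ 2 := by positivity
  linarith

theorem integral_heatKernel (d : ℕ) {t : ℝ} (ht : 0 < t) : ∫ x, heatKernel d t x = 1 := by
  unfold heatKernel
  rw [integral_const_mul, GaussianFourier.integral_rexp_neg_mul_sq_norm (by positivity),
    finrank_euclideanSpace_fin, show Real.pi / (1 / (4 * t)) = 4 * Real.pi * t by field_simp,
    ← Real.rpow_add (by positivity)]
  simp

theorem integrable_heatKernel (d : ℕ) {t : ℝ} (ht : 0 < t) : Integrable (heatKernel d t) :=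
  Integrable.of_integral_ne_zero (by rw [integral_heatKernel d ht]; exact one_ne_zero)

theorem lintegral_heatKernel (d : ℕ) {t : ℝ} (ht : 0 < t) :
    ∫⁻ x, ENNReal.ofReal (heatKernel d t x) = 1 := by
  rw [← ofReal_integral_eq_lintegral_ofReal (integrable_heatKernel d ht)
    (ae_of_all _ (heatKernel_nonneg d ht.le)), integral_heatKernel d ht, ENNReal.ofReal_one]

theorem enorm_heatKernel (d : ℕ) {t : ℝ} (ht : 0 ≤ t) (x : Sp d) :
    ‖(heatKernel d t x : ℂ)‖ₑ = ENNReal.ofReal (heatKernel d t x) := by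
  rw [← ofReal_norm, Complex.norm_real, Real.norm_of_nonneg (heatKernel_nonneg d ht x)]

theorem fourier_heatKernel (d : ℕ) {t : ℝ} (ht : 0 < t) :
    𝓕 (fun x : Sp d => (heatKernel d t x : ℂ)) = heatSymbol d t := by
  have hb : 0 < ((1 / (4 * t) : ℝ) : ℂ).re := by rw [Complex.ofReal_re]; positivity
  have h0 : (4 * Real.pi * t : ℝ) ≠ 0 := by positivity
  have e : (fun x : Sp d => (heatKernel d t x : ℂ)) =
      (((4 * Real.pi * t) ^ (-(d / 2 : ℝ)) : ℝ) : ℂ) •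
        fun x : Sp d => Complex.exp (-((1 / (4 * t) : ℝ) : ℂ) * (‖x‖ : ℂ) ^ 2) := by
    funext x
    simp [heatKernel]
  rw [e]
  funext w
  have h1 : 𝓕 ((((4 * Real.pi * t) ^ (-(d / 2 : ℝ)) : ℝ) : ℂ) •
        fun x : Sp d => Complex.exp (-((1 / (4 * t) : ℝ) : ℂ) * (‖x‖ : ℂ) ^ 2)) w =
      (((4 * Real.pi * t) ^ (-(d / 2 : ℝ)) : ℝ) : ℂ) •
        𝓕 (fun x : Sp d => Complex.exp (-((1 / (4 * t) : ℝ) : ℂ) * (‖x‖ : ℂ) ^ 2)) w := by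
    simp only [Real.fourier_eq, Pi.smul_apply, ← integral_smul]
    congr 1
    funext v
    rw [smul_comm]
  rw [h1, fourier_gaussian_innerProductSpace hb, finrank_euclideanSpace_fin, ← Complex.ofReal_div,
    show Real.pi / (1 / (4 * t)) = 4 * Real.pi * t by field_simp,
    Complex.ofReal_cpow (by positivity), smul_eq_mul, ← mul_assoc]
  have h2 : ((4 * Real.pi * t : ℝ) : ℂ) ^ ((-(d / 2 : ℝ) : ℝ) : ℂ) *
      ((4 * Real.pi * t : ℝ) : ℂ) ^ ((d : ℂ) / 2) = 1 := by
    rw [← Complex.cpow_add _ _ (by exact_mod_cast h0)]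
    simp
  rw [h2, one_mul, heatSymbol, Complex.ofReal_exp]
  congr 1
  rw [norm_smul, Real.norm_of_nonneg (by positivity)]
  push_cast
  have : (t : ℂ) ≠ 0 := by exact_mod_cast ht.ne'
  field_simp
  ring

/-- The `L^r` norm of the heat kernel. -/
theorem lintegral_heatKernel_rpow_le (d : ℕ) {t : ℝ} (ht : 0 < t) {r : ℝ} (hr : 1 ≤ r) :
    ∫⁻ x, ENNReal.ofReal (heatKernel d t x) ^ r ≤
      ENNReal.ofReal (t ^ (-(d / 2 * (1 - 1 / r)))) ^ r := by
  have hr0 : 0 < r := by linarith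
  set M : ℝ := (4 * Real.pi * t) ^ (-(d / 2 : ℝ))
  have hM : 0 ≤ M := by positivity
  -- Interpolation between the sup bound M and unit mass: K^r ≤ M^{r-1} K.
  have h1 : ∀ x : Sp d, ENNReal.ofReal (heatKernel d t x) ^ r ≤
      ENNReal.ofReal (M ^ (r - 1)) * ENNReal.ofReal (heatKernel d t x) := by
    intro x
    have h0 := heatKernel_nonneg d ht.le x
    rw [ENNReal.ofReal_rpow_of_nonneg h0 hr0.le, ← ENNReal.ofReal_mul (by positivity)]
    apply ENNReal.ofReal_le_ofReal
    calc heatKernel d t x ^ r = heatKernel d t x ^ (r - 1) * heatKernel d t x := by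
          nth_rw 3 [← Real.rpow_one (heatKernel d t x)]
          rw [← Real.rpow_add_of_nonneg h0 (by linarith) zero_le_one]
          simp
      _ ≤ M ^ (r - 1) * heatKernel d t x := by
          gcongr
          exact heatKernel_le d ht x
  refine (lintegral_mono h1).trans ?_
  rw [lintegral_const_mul _ (measurable_heatKernel_right d t).ennreal_ofReal,
    lintegral_heatKernel d ht, mul_one, ENNReal.ofReal_rpow_of_nonneg (by positivity) hr0.le]
  apply ENNReal.ofReal_le_ofReal
  -- The constant (4π)^{-d/2} is at most 1 and is dropped.
  have hM' : M ≤ t ^ (-(d / 2 : ℝ)) := by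
    refine Real.rpow_le_rpow_of_nonpos ht ?_ (by simp; positivity)
    nlinarith [Real.pi_gt_three]
  calc M ^ (r - 1) ≤ (t ^ (-(d / 2 : ℝ))) ^ (r - 1) :=
        Real.rpow_le_rpow hM hM' (by linarith)
    _ = _ := by
        rw [← Real.rpow_mul ht.le, ← Real.rpow_mul ht.le]
        congr 1
        field_simp

/-- The Gaussian factor increases with time, so only the normalisation is lost. This one-sided
comparison replaces any estimate of the time derivative of the kernel. -/
theorem heatKernel_ratio_le (d : ℕ) {t s : ℝ} (ht : 0 < t) (hs : 0 ≤ s) (x : Sp d) :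
    (1 + s / t) ^ (-(d / 2 : ℝ)) * heatKernel d t x ≤ heatKernel d (t + s) x := by
  unfold heatKernel
  rw [← mul_assoc, ← Real.mul_rpow (by positivity) (by positivity),
    show (1 + s / t) * (4 * Real.pi * t) = 4 * Real.pi * (t + s) by field_simp]
  gcongr
  linarith

/-- Writing the product as exp(-(u + κ log(1+y))), this is 1 - e^{-z} ≤ z followed by log(1+y) ≤ y.
-/
theorem one_sub_exp_mul_rpow_le {κ u y : ℝ} (hκ : 0 ≤ κ) (hy : 0 ≤ y) :
    1 - Real.exp (-u) * (1 + y) ^ (-κ) ≤ u + κ * y := by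
  rw [Real.rpow_def_of_pos (by linarith), ← Real.exp_add]
  have h1 := Real.add_one_le_exp (-u + Real.log (1 + y) * -κ)
  have h2 := Real.log_le_sub_one_of_pos (show 0 < 1 + y by linarith)
  nlinarith

/-- The `L¹` modulus of continuity in time of the (damped) heat kernel. -/
theorem integral_abs_heatKernel_sub_le (d : ℕ) {t s u : ℝ} (ht : 0 < t) (hs : 0 ≤ s)
    (hu : 0 ≤ u) :
    ∫ x, |heatKernel d t x - Real.exp (-u) * heatKernel d (t + s) x| ≤
      min 2 (2 * u + d * (s / t)) := by
  have hts : 0 < t + s := by linarith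
  set c := Real.exp (-u)
  set θ : ℝ := (1 + s / t) ^ (-(d / 2 : ℝ))
  have hc : 0 ≤ c := by positivity
  have hc1 : c ≤ 1 := Real.exp_le_one_iff.2 (by linarith)
  have hθ : 0 ≤ θ := by positivity
  have hθ1 : θ ≤ 1 := Real.rpow_le_one_of_one_le_of_nonpos
    (by linarith [div_nonneg hs ht.le]) (by simp; positivity)
  have hcθ : c * θ ≤ 1 := mul_le_one₀ hc1 hθ hθ1
  -- Both kernels lie above cθK_t, so their distance is at most the sum of the two nonnegative
  -- excesses. These have masses 1 - cθ and c - cθ, whence the bound 2(1 - cθ).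
  have h1 : ∀ x : Sp d, |heatKernel d t x - c * heatKernel d (t + s) x| ≤
      (1 - c * θ) * heatKernel d t x +
        (c * heatKernel d (t + s) x - c * θ * heatKernel d t x) := by
    intro x
    have a1 := heatKernel_nonneg d ht.le x
    have a2 : 0 ≤ c * (heatKernel d (t + s) x - θ * heatKernel d t x) :=
      mul_nonneg hc (sub_nonneg.2 (heatKernel_ratio_le d ht hs x))
    have a3 : 0 ≤ (1 - c * θ) * heatKernel d t x := mul_nonneg (by linarith) a1
    rw [abs_le]
    constructor <;> nlinarith
  have i1 := integrable_heatKernel d ht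
  have i2 := integrable_heatKernel d hts
  have h2 : ∫ x, |heatKernel d t x - c * heatKernel d (t + s) x| ≤ 2 * (1 - c * θ) := by
    refine (integral_mono ((i1.sub (i2.const_mul c)).abs)
      ((i1.const_mul _).add ((i2.const_mul c).sub (i1.const_mul _))) h1).trans ?_
    have i3 : Integrable fun x => c * heatKernel d (t + s) x - c * θ * heatKernel d t x :=
      (i2.const_mul c).sub (i1.const_mul _)
    change ∫ x, ((1 - c * θ) * heatKernel d t x +
      (c * heatKernel d (t + s) x - c * θ * heatKernel d t x)) ≤ _
    rw [integral_add (i1.const_mul _) i3, integral_sub (i2.const_mul c) (i1.const_mul _)]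
    simp only [integral_const_mul, integral_heatKernel d ht, integral_heatKernel d hts]
    linarith
  refine h2.trans (le_min ?_ ?_)
  · linarith [mul_nonneg hc hθ]
  · have := one_sub_exp_mul_rpow_le (κ := d / 2) (u := u) (y := s / t) (by positivity)
      (by positivity)
    linarith

theorem lintegral_enorm_heatKernel_sub_le (d : ℕ) {t s u : ℝ} (ht : 0 < t) (hs : 0 ≤ s)
    (hu : 0 ≤ u) :
    ∫⁻ x, ‖((heatKernel d t x - Real.exp (-u) * heatKernel d (t + s) x : ℝ) : ℂ)‖ₑ ≤
      ENNReal.ofReal (min 2 (2 * u + d * (s / t))) := by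
  have hi : Integrable fun x => |heatKernel d t x - Real.exp (-u) * heatKernel d (t + s) x| :=
    ((integrable_heatKernel d ht).sub ((integrable_heatKernel d (show 0 < t + s by linarith)).const_mul (Real.exp (-u)))).abs
  refine le_trans (le_of_eq ?_)
    (ENNReal.ofReal_le_ofReal (integral_abs_heatKernel_sub_le d ht hs hu))
  rw [ofReal_integral_eq_lintegral_ofReal hi (ae_of_all _ fun x => abs_nonneg _)]
  refine lintegral_congr fun x => ?_
  rw [← ofReal_norm, Complex.norm_real, Real.norm_eq_abs]

theorem heatSymbol_zero (d : ℕ) : heatSymbol d 0 = fun _ => 1 := by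
  funext ξ
  simp [heatSymbol]

theorem heatSymbol_mul (d : ℕ) (t s : ℝ) :
    heatSymbol d t * heatSymbol d s = heatSymbol d (t + s) := by
  funext ξ
  simp only [heatSymbol, Pi.mul_apply]
  rw [← Complex.ofReal_mul, ← Real.exp_add]
  ring_nf

theorem besselSymbol_mul (d : ℕ) (s s' : ℝ) :
    besselSymbol d s * besselSymbol d s' = besselSymbol d (s + s') := by
  funext ξ
  simp only [besselSymbol, Pi.mul_apply]
  rw [← Complex.ofReal_mul, ← Real.rpow_add (by positivity)]
  ring_nf

theorem besselSymbol_zero (d : ℕ) : besselSymbol d 0 = fun _ => 1 := by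
  funext ξ
  simp [besselSymbol]

/-- The heat semigroup maps `L^p` to `L^q`. -/
theorem multBound_heat (d : ℕ) {p q : ℝ≥0∞} [Fact (1 ≤ p)] [Fact (1 ≤ q)] (hp : p ≠ ⊤)
    (hq : q ≠ ⊤) (hpq : p.toReal ≤ q.toReal) {t : ℝ} (ht : 0 < t) :
    MultBound (heatSymbol d t) p q
      (t ^ (-(d / 2 * (1 / p.toReal - 1 / q.toReal)))) := by
  have hp1 : 1 ≤ p.toReal := by
    rw [← ENNReal.toReal_one]
    exact ENNReal.toReal_mono hp Fact.out
  have hq1 : 1 ≤ q.toReal := hp1.trans hpq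
  have e1 : 1 / q.toReal ≤ 1 / p.toReal := one_div_le_one_div_of_le (by linarith) hpq
  have e2 : 1 / p.toReal ≤ 1 := (div_le_one (by linarith)).2 hp1
  have e3 : 0 < 1 / q.toReal := by positivity
  -- y is the reciprocal of the exponent r that Young's inequality requires of the kernel.
  set y := 1 + 1 / q.toReal - 1 / p.toReal with hy
  have hy0 : 0 < y := by linarith
  have hr1 : 1 ≤ 1 / y := (one_le_div hy0).2 (by linarith)
  refine multBound_of_kernel hp hq (r := 1 / y) (by linarith) hpq ?_ ?_
    (heatSymbol_hasTemperateGrowth d ht.le)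
    (Complex.measurable_ofReal.comp (measurable_heatKernel_right d t))
    (integrable_heatKernel d ht).ofReal (fourier_heatKernel d ht) (by positivity) ?_
  · rw [div_le_iff₀ hy0]
    have : q.toReal * (1 / q.toReal) = 1 := by field_simp
    nlinarith
  · rw [one_div_one_div]
    linarith
  · simp only [Function.comp_def, enorm_heatKernel d ht.le]
    convert lintegral_heatKernel_rpow_le d ht hr1 using 4
    rw [one_div_one_div]
    linarith

/-- The heat semigroup is a contraction of `L^p`. -/
theorem multBound_heat_self (d : ℕ) {p : ℝ≥0∞} [Fact (1 ≤ p)] (hp : p ≠ ⊤) {t : ℝ}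
    (ht : 0 ≤ t) : MultBound (heatSymbol d t) p p 1 := by
  -- At t = 0 there is no kernel, and the multiplier is the identity.
  rcases ht.eq_or_lt with rfl | ht
  · intro f
    refine ⟨f, ?_, by simp⟩
    rw [heatSymbol_zero]
    simp
  · simpa using multBound_heat d hp hp le_rfl ht

end QuadraticHeat

end

/-! ### Superpositions of heat kernels and the smoothing estimate -/

noncomputable section

namespace QuadraticHeat

open FourierTransform TemperedDistribution

theorem integrable_ofReal_heatKernel (d : ℕ) {t : ℝ} (ht : 0 < t) :
    Integrable fun x => (heatKernel d t x : ℂ) :=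
  (integrable_heatKernel d ht).ofReal

theorem fourier_const_mul_sub {d : ℕ} {f g : Sp d → ℂ} (hf : Integrable f) (hg : Integrable g)
    (a b : ℂ) (ξ : Sp d) :
    𝓕 (fun x => a * f x - b * g x) ξ = a * 𝓕 f ξ - b * 𝓕 g ξ := by
  have hc : ∀ {u : Sp d → ℂ}, Integrable u →
      Integrable fun v => Real.fourierChar (-inner ℝ v ξ) • u v := fun hu =>
    (VectorFourier.fourierIntegral_convergent_iff
      (L := innerₗ (Sp d)) Real.continuous_fourierChar continuous_inner ξ).2 hu
  simp only [Real.fourier_eq, ← integral_const_mul]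
  rw [← integral_sub ((hc hf).const_mul a) ((hc hg).const_mul b)]
  congr 1
  funext v
  simp only [Circle.smul_def, smul_eq_mul]
  ring

/-- Superpositions of integrable kernels. -/
theorem fourier_integral_superposition {d : ℕ} {ν : Measure ℝ} [SFinite ν] {k : ℝ → Sp d → ℂ}
    (hk : Measurable (Function.uncurry k)) (hfin : ∫⁻ s, (∫⁻ x, ‖k s x‖ₑ) ∂ν < ⊤) :
    Measurable (fun x => ∫ s, k s x ∂ν) ∧ Integrable (fun x => ∫ s, k s x ∂ν) ∧
      ∀ ξ, 𝓕 (fun x => ∫ s, k s x ∂ν) ξ = ∫ s, 𝓕 (k s) ξ ∂ν := by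
  have hint : Integrable (Function.uncurry k) (ν.prod volume) := by
    refine ⟨hk.aestronglyMeasurable, ?_⟩
    rw [HasFiniteIntegral, lintegral_prod _ hk.enorm.aemeasurable]
    exact hfin
  refine ⟨(StronglyMeasurable.integral_prod_left hk.stronglyMeasurable).measurable,
    hint.integral_prod_right, fun ξ => ?_⟩
  simp only [Real.fourier_eq]
  have hm : Measurable fun z : Sp d × ℝ => ((Real.fourierChar (-inner ℝ z.1 ξ) : Circle) : ℂ) := by
    have : Continuous fun z : Sp d × ℝ => ((Real.fourierChar (-inner ℝ z.1 ξ) : Circle) : ℂ) :=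
      continuous_subtype_val.comp (Real.continuous_fourierChar.comp (by fun_prop))
    exact this.measurable
  rw [← integral_integral_swap (f := fun v s => Real.fourierChar (-inner ℝ v ξ) • k s v)]
  · congr 1
    funext v
    simp only [Circle.smul_def]
    rw [integral_smul]
  · refine hint.swap.congr' ?_ (ae_of_all _ fun z => ?_)
    · exact (hm.mul (hk.comp measurable_swap)).aestronglyMeasurable
    · simp [Function.uncurry]

/-- Fubini carries the s-integral through the Fourier transform, and Young with r = 1 bounds the
operator by the total L¹ mass of the family. -/
theorem multBound_of_superposition {d : ℕ} {σ : Sp d → ℂ} {p : ℝ≥0∞} [Fact (1 ≤ p)] (hp : p ≠ ⊤)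
    {ν : Measure ℝ} [SFinite ν] {k : ℝ → Sp d → ℂ} (hk : Measurable (Function.uncurry k))
    (hσ : σ.HasTemperateGrowth) (hkσ : ∀ ξ, ∫ s, 𝓕 (k s) ξ ∂ν = σ ξ) {A : ℝ} (hA : 0 ≤ A)
    (hkA : ∫⁻ s, (∫⁻ x, ‖k s x‖ₑ) ∂ν ≤ ENNReal.ofReal A) : MultBound σ p p A := by
  obtain ⟨h1, h2, h3⟩ := fourier_integral_superposition hk (hkA.trans_lt ENNReal.ofReal_lt_top)
  have hp1 : 1 ≤ p.toReal := by
    rw [← ENNReal.toReal_one]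
    exact ENNReal.toReal_mono hp Fact.out
  refine multBound_of_kernel hp hp one_pos le_rfl hp1 (by simp) hσ h1 h2
    (funext fun ξ => (h3 ξ).trans (hkσ ξ)) hA ?_
  simp only [ENNReal.rpow_one]
  calc _ ≤ ∫⁻ x, ∫⁻ s, ‖k s x‖ₑ ∂ν := lintegral_mono fun x => enorm_integral_le_lintegral_enorm _
    _ = ∫⁻ s, (∫⁻ x, ‖k s x‖ₑ) ∂ν := by
      rw [lintegral_lintegral_swap]
      exact (hk.comp measurable_swap).enorm.aemeasurable
    _ ≤ _ := hkA

/-- Near 0 the branch D s leaves s^{-a}, integrable as a < 1; at infinity the branch 2 leaves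
s^{-1-a}, integrable as a > 0. -/
theorem integrableOn_rpow_mul_min {a D : ℝ} (ha0 : 0 < a) (ha1 : a < 1) (hD : 0 ≤ D) :
    IntegrableOn (fun s : ℝ => s ^ (-1 - a) * min 2 (D * s)) (Ioi 0) := by
  have hm : Measurable fun s : ℝ => s ^ (-1 - a) * min 2 (D * s) := by fun_prop
  rw [← Ioc_union_Ioi_eq_Ioi (zero_le_one' ℝ), integrableOn_union]
  constructor
  · have h1 : IntegrableOn (fun s : ℝ => D * s ^ (-a)) (Ioc 0 1) :=
      ((intervalIntegrable_iff_integrableOn_Ioc_of_le zero_le_one).1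
        (intervalIntegral.intervalIntegrable_rpow' (by linarith))).const_mul _
    refine h1.mono' hm.aestronglyMeasurable ?_
    filter_upwards [ae_restrict_mem measurableSet_Ioc] with s hs
    have hs0 : 0 < s := hs.1
    rw [Real.norm_of_nonneg (by positivity), show -a = (-1 - a) + 1 by ring,
      Real.rpow_add_one hs0.ne']
    calc _ ≤ s ^ (-1 - a) * (D * s) := by gcongr; exact min_le_right _ _
      _ = _ := by ring
  · have h1 : IntegrableOn (fun s : ℝ => 2 * s ^ (-1 - a)) (Ioi 1) :=
      (integrableOn_Ioi_rpow_of_lt (by linarith) one_pos).const_mul _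
    refine h1.mono' hm.aestronglyMeasurable ?_
    filter_upwards [ae_restrict_mem measurableSet_Ioi] with s hs
    have hs0 : 0 < s := one_pos.trans hs
    rw [Real.norm_of_nonneg (by positivity), mul_comm 2]
    gcongr
    exact min_le_left _ _

/-- Rescaling s by t; the factor t^{-a} becomes the smoothing rate of the semigroup. -/
theorem integral_rpow_mul_min_div (a D : ℝ) {t : ℝ} (ht : 0 < t) :
    ∫ s in Ioi (0 : ℝ), s ^ (-1 - a) * min 2 (D * (s / t)) =
      t ^ (-a) * ∫ s in Ioi (0 : ℝ), s ^ (-1 - a) * min 2 (D * s) := by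
  have h := integral_comp_mul_left_Ioi (fun s : ℝ => s ^ (-1 - a) * min 2 (D * s)) 0
    (inv_pos.2 ht)
  simp only [mul_zero, inv_inv, smul_eq_mul] at h
  have e : t ^ (-a) = t ^ (-1 - a) * t := by
    rw [← Real.rpow_add_one ht.ne']
    ring_nf
  rw [e, mul_assoc, ← h, ← integral_const_mul]
  refine setIntegral_congr_fun measurableSet_Ioi fun s hs => ?_
  have hs0 : (0 : ℝ) < s := hs
  rw [Real.mul_rpow (by positivity) hs0.le, Real.inv_rpow ht.le, div_eq_inv_mul]
  have : t ^ (-1 - a) ≠ 0 := by positivity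
  field_simp

/-- The integral representation of `λ^a` for `0 < a < 1`. -/
theorem exists_integral_rpow_mul_one_sub_exp {a : ℝ} (ha0 : 0 < a) (ha1 : a < 1) :
    ∃ c : ℝ, 0 < c ∧ ∀ l : ℝ, 0 < l →
      ∫ s in Ioi (0 : ℝ), s ^ (-1 - a) * (1 - Real.exp (-(l * s))) = c * l ^ a := by
  have hi : IntegrableOn (fun s : ℝ => s ^ (-1 - a) * (1 - Real.exp (-s))) (Ioi 0) := by
    refine (integrableOn_rpow_mul_min ha0 ha1 zero_le_one).mono'
      (by fun_prop : Measurable _).aestronglyMeasurable ?_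
    filter_upwards [ae_restrict_mem measurableSet_Ioi] with s hs
    have hs0 : (0 : ℝ) < s := hs
    have h1 : Real.exp (-s) ≤ 1 := Real.exp_le_one_iff.2 (by linarith)
    have h2 := Real.add_one_le_exp (-s)
    have h3 := Real.exp_pos (-s)
    rw [Real.norm_of_nonneg (mul_nonneg (by positivity) (by linarith))]
    gcongr
    exact le_min (by linarith) (by linarith)
  have hpos : ∀ s ∈ Ioi (0 : ℝ), 0 < s ^ (-1 - a) * (1 - Real.exp (-s)) := by
    intro s hs
    have hs0 : (0 : ℝ) < s := hs
    have h1 : Real.exp (-s) < 1 := Real.exp_lt_one_iff.2 (by linarith)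
    exact mul_pos (by positivity) (by linarith)
  -- The constant is the value at l = 1; the general case is the substitution s ↦ l s. Only
  -- positivity of c matters later.
  refine ⟨∫ s in Ioi (0 : ℝ), s ^ (-1 - a) * (1 - Real.exp (-s)), ?_, fun l hl => ?_⟩
  · rw [setIntegral_pos_iff_support_of_nonneg_ae _ hi]
    · have : Function.support (fun s : ℝ => s ^ (-1 - a) * (1 - Real.exp (-s))) ∩ Ioi 0 =
          Ioi 0 := inter_eq_right.2 fun s hs => (hpos s hs).ne'
      rw [this]
      simp
    · filter_upwards [ae_restrict_mem measurableSet_Ioi] with s hs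
      exact (hpos s hs).le
  · have h := integral_comp_mul_left_Ioi
      (fun s : ℝ => s ^ (-1 - a) * (1 - Real.exp (-s))) 0 hl
    simp only [mul_zero, smul_eq_mul] at h
    have e : l ^ a = l ^ (1 + a) * l⁻¹ := by
      rw [add_comm, Real.rpow_add_one hl.ne']
      field_simp
    rw [e, mul_comm, mul_assoc, ← h, ← integral_const_mul]
    refine setIntegral_congr_fun measurableSet_Ioi fun s hs => ?_
    have hs0 : (0 : ℝ) < s := hs
    rw [Real.mul_rpow hl.le hs0.le, show -1 - a = -(1 + a) by ring, Real.rpow_neg hl.le]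
    have : l ^ (1 + a) ≠ 0 := by positivity
    field_simp

/-- The smoothing effect of the heat semigroup: `(1 - Δ)^{β/2} e^{tΔ}` is bounded on `L^p` with
norm at most `C t^{-β/2}`. -/
theorem exists_multBound_heat_mul_bessel (d : ℕ) {p : ℝ≥0∞} [Fact (1 ≤ p)] (hp : p ≠ ⊤) {β : ℝ}
    (hβ0 : 0 < β) (hβ2 : β < 2) :
    ∃ C : ℝ, 0 ≤ C ∧ ∀ t : ℝ, 0 < t → t ≤ 1 →
      MultBound (heatSymbol d t * besselSymbol d β) p p (C * t ^ (-(β / 2))) := by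
  set a := β / 2
  have ha0 : 0 < a := by positivity
  have ha1 : a < 1 := by simp only [a]; linarith
  obtain ⟨c, hc, hcl⟩ := exists_integral_rpow_mul_one_sub_exp ha0 ha1
  -- For t ≤ 1 one has s ≤ s/t, so the modulus 2s + d(s/t) is at most D(s/t).
  set D : ℝ := 2 + d
  set I : ℝ := ∫ s in Ioi (0 : ℝ), s ^ (-1 - a) * min 2 (D * s)
  have hI : 0 ≤ I := setIntegral_nonneg measurableSet_Ioi fun s hs => by
    have hs0 : (0 : ℝ) < s := hs
    positivity
  refine ⟨c⁻¹ * I, by positivity, fun t ht ht1 => ?_⟩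
  have hσ : (heatSymbol d t * besselSymbol d β).HasTemperateGrowth :=
    (heatSymbol_hasTemperateGrowth d ht.le).mul (besselSymbol_hasTemperateGrowth d β)
  -- Kernel of s^{-1-a}(1 - e^{-λs}) e^{-t|ζ|²} with λ = 1 + |ζ|²: the factor e^{-λs} is the damping
  -- e^{-s} together with an advance of heat time from t to t + s.
  set k : ℝ → Sp d → ℂ := fun s x => ((s ^ (-1 - a) : ℝ) : ℂ) *
    ((heatKernel d t x - Real.exp (-s) * heatKernel d (t + s) x : ℝ) : ℂ) with hk
  have hkm : Measurable (Function.uncurry k) := by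
    have m1 : Measurable fun z : ℝ × Sp d => heatKernel d t z.2 :=
      (measurable_heatKernel_right d t).comp measurable_snd
    have m2 : Measurable fun z : ℝ × Sp d => heatKernel d (t + z.1) z.2 :=
      (measurable_heatKernel d).comp ((measurable_const.add measurable_fst).prodMk measurable_snd)
    simp only [hk, Function.uncurry_def]
    fun_prop
  have hσc : ((c : ℂ) • (heatSymbol d t * besselSymbol d β)).HasTemperateGrowth := by
    have := (Function.HasTemperateGrowth.const (E := Sp d) (c : ℂ)).mul hσ
    exact this
  have key : MultBound ((c : ℂ) • (heatSymbol d t * besselSymbol d β)) p p (I * t ^ (-a)) := by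
    refine multBound_of_superposition hp (ν := volume.restrict (Ioi 0)) hkm hσc (fun ξ => ?_)
      (by positivity) ?_
    · have h1 : ∀ s ∈ Ioi (0 : ℝ), 𝓕 (k s) ξ =
          ((Real.exp (-t * ‖(2 * Real.pi) • ξ‖ ^ 2) * (s ^ (-1 - a) *
            (1 - Real.exp (-((1 + ‖(2 * Real.pi) • ξ‖ ^ 2) * s)))) : ℝ) : ℂ) := by
        intro s hs
        have hs0 : (0 : ℝ) < s := hs
        have hts : 0 < t + s := by linarith
        have e : k s = fun x => ((s ^ (-1 - a) : ℝ) : ℂ) * (heatKernel d t x : ℂ) -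
            ((s ^ (-1 - a) * Real.exp (-s) : ℝ) : ℂ) * (heatKernel d (t + s) x : ℂ) := by
          funext x
          simp only [hk]
          push_cast
          ring
        rw [e, fourier_const_mul_sub (integrable_ofReal_heatKernel d ht)
          (integrable_ofReal_heatKernel d hts), fourier_heatKernel d ht, fourier_heatKernel d hts]
        simp only [heatSymbol, ← Complex.ofReal_mul, ← Complex.ofReal_sub]
        congr 1
        have : Real.exp (-(t + s) * ‖(2 * Real.pi) • ξ‖ ^ 2) * Real.exp (-s) =
            Real.exp (-t * ‖(2 * Real.pi) • ξ‖ ^ 2) *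
              Real.exp (-((1 + ‖(2 * Real.pi) • ξ‖ ^ 2) * s)) := by
          rw [← Real.exp_add, ← Real.exp_add]
          ring_nf
        linear_combination (-(s ^ (-1 - a))) * this
      rw [setIntegral_congr_fun measurableSet_Ioi h1, integral_complex_ofReal, integral_const_mul,
        hcl _ (by positivity)]
      simp only [Pi.smul_apply, Pi.mul_apply, heatSymbol, besselSymbol, smul_eq_mul, a]
      push_cast
      ring
    · have hgi : IntegrableOn (fun s : ℝ => s ^ (-1 - a) * min 2 (D * (s / t))) (Ioi 0) := by
        have := integrableOn_rpow_mul_min (D := D / t) ha0 ha1 (by positivity)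
        refine this.congr_fun (fun s _ => ?_) measurableSet_Ioi
        simp only
        rw [div_mul_eq_mul_div, mul_div_assoc]
      rw [mul_comm I, ← integral_rpow_mul_min_div a D ht,
        ofReal_integral_eq_lintegral_ofReal hgi]
      · refine setLIntegral_mono' measurableSet_Ioi fun s hs => ?_
        have hs0 : (0 : ℝ) < s := hs
        simp only [hk, enorm_mul]
        rw [lintegral_const_mul' _ _ enorm_ne_top, ENNReal.ofReal_mul (by positivity),
          ← ofReal_norm, Complex.norm_real, Real.norm_of_nonneg (by positivity)]
        refine mul_le_mul_right
          ((lintegral_enorm_heatKernel_sub_le d ht hs0.le hs0.le).trans ?_) _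
        refine ENNReal.ofReal_le_ofReal (min_le_min le_rfl ?_)
        have : s ≤ s / t := by rw [le_div_iff₀ ht]; nlinarith
        simp only [D]
        linarith
      · filter_upwards [ae_restrict_mem measurableSet_Ioi] with s hs
        have hs0 : (0 : ℝ) < s := hs
        simp only [Pi.zero_apply]
        positivity
  have h2 := key.const_smul hσc ((c : ℂ)⁻¹)
  rw [smul_smul, inv_mul_cancel₀ (by exact_mod_cast hc.ne'), one_smul] at h2
  convert h2 using 1
  rw [norm_inv, Complex.norm_real, Real.norm_of_nonneg hc.le, mul_assoc]

end QuadraticHeat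

end

/-! ### Bessel potentials: Sobolev embedding and rate of continuity at time zero -/

noncomputable section

namespace QuadraticHeat

open FourierTransform TemperedDistribution

theorem lintegral_exp_mul_rpow {a : ℝ} (ha : 0 < a) :
    ∫⁻ s in Ioi (0 : ℝ), ENNReal.ofReal (Real.exp (-s) * s ^ (a - 1)) =
      ENNReal.ofReal (Real.Gamma a) := by
  rw [Real.Gamma_eq_integral ha,
    ofReal_integral_eq_lintegral_ofReal (Real.GammaIntegral_convergent ha)]
  filter_upwards [ae_restrict_mem measurableSet_Ioi] with s hs
  have hs0 : (0 : ℝ) < s := hs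
  simp only [Pi.zero_apply]
  positivity

/-- The representation of the Bessel potential as a superposition of heat semigroups. -/
theorem integral_exp_mul_rpow_mul_heatSymbol (d : ℕ) {β : ℝ} (hβ : 0 < β) (t : ℝ) (ξ : Sp d) :
    ∫ s in Ioi (0 : ℝ), ((Real.exp (-s) * s ^ (β / 2 - 1) : ℝ) : ℂ) * heatSymbol d (s + t) ξ =
      (Real.Gamma (β / 2) : ℂ) * (heatSymbol d t ξ * besselSymbol d (-β) ξ) := by
  set z : ℝ := ‖(2 * Real.pi) • ξ‖ ^ 2 with hz
  have hz0 : 0 ≤ z := by positivity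
  have h1 : ∀ s ∈ Ioi (0 : ℝ),
      ((Real.exp (-s) * s ^ (β / 2 - 1) : ℝ) : ℂ) * heatSymbol d (s + t) ξ =
        ((Real.exp (-t * z) * (s ^ (β / 2 - 1) * Real.exp (-((1 + z) * s))) : ℝ) : ℂ) := by
    intro s _
    simp only [heatSymbol, ← hz, ← Complex.ofReal_mul]
    congr 1
    have : Real.exp (-s) * Real.exp (-(s + t) * z) =
        Real.exp (-t * z) * Real.exp (-((1 + z) * s)) := by
      rw [← Real.exp_add, ← Real.exp_add]
      ring_nf
    linear_combination (s ^ (β / 2 - 1)) * this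
  rw [setIntegral_congr_fun measurableSet_Ioi h1, integral_complex_ofReal, integral_const_mul,
    Real.integral_rpow_mul_exp_neg_mul_Ioi (by positivity) (by positivity)]
  simp only [heatSymbol, besselSymbol, ← hz]
  rw [one_div, Real.inv_rpow (by positivity), neg_div, Real.rpow_neg (by positivity)]
  push_cast
  ring

/-- The Sobolev embedding `W^{β,p} ⊆ L^q`, in the subcritical range. -/
theorem exists_multBound_bessel_neg (d : ℕ) {p q : ℝ≥0∞} [Fact (1 ≤ p)] [Fact (1 ≤ q)]
    (hp : p ≠ ⊤) (hq : q ≠ ⊤) (hpq : p.toReal ≤ q.toReal) {β : ℝ} (hβ : 0 < β)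
    (h : d * (1 / p.toReal - 1 / q.toReal) < β) :
    ∃ A : ℝ, 0 ≤ A ∧ MultBound (besselSymbol d (-β)) p q A := by
  have hp1 : 1 ≤ p.toReal := by
    rw [← ENNReal.toReal_one]
    exact ENNReal.toReal_mono hp Fact.out
  have hq1 : 1 ≤ q.toReal := hp1.trans hpq
  have e1 : 1 / q.toReal ≤ 1 / p.toReal := one_div_le_one_div_of_le (by linarith) hpq
  have e2 : 1 / p.toReal ≤ 1 := (div_le_one (by linarith)).2 hp1
  have e3 : 0 < 1 / q.toReal := by positivity
  set y := 1 + 1 / q.toReal - 1 / p.toReal with hy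
  have hy0 : 0 < y := by linarith
  have hr1 : 1 ≤ 1 / y := (one_le_div hy0).2 (by linarith)
  set r := 1 / y with hr
  have hry : 1 / r = y := one_div_one_div y
  set a := β / 2 with ha
  -- The L^r norm of K_s is at most s^{-κ}, and subcriticality is exactly κ < a. The Bessel kernel
  -- then has L^r norm at most Γ(a - κ)/Γ(a).
  set κ : ℝ := d / 2 * (1 - 1 / r) with hκ
  have ha0 : 0 < a := by positivity
  have hκa : 0 < a - κ := by
    rw [hκ, hry, ha]
    have : (1 - y) = 1 / p.toReal - 1 / q.toReal := by rw [hy]; ring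
    rw [this]
    linarith
  have hG : 0 < Real.Gamma a := Real.Gamma_pos_of_pos ha0
  have hGκ : 0 < Real.Gamma (a - κ) := Real.Gamma_pos_of_pos hκa
  set k : ℝ → Sp d → ℂ := fun s x =>
    ((Real.exp (-s) * s ^ (a - 1) : ℝ) : ℂ) * (heatKernel d s x : ℂ) with hk
  have hkm : Measurable (Function.uncurry k) := by
    have m2 := measurable_heatKernel d
    simp only [hk, Function.uncurry_def]
    fun_prop
  have hke : ∀ s ∈ Ioi (0 : ℝ), ∀ x, ‖k s x‖ₑ =
      ENNReal.ofReal (Real.exp (-s) * s ^ (a - 1)) * ENNReal.ofReal (heatKernel d s x) := by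
    intro s hs x
    have hs0 : (0 : ℝ) < s := hs
    simp only [hk, enorm_mul]
    rw [enorm_heatKernel d hs0.le, ← ofReal_norm, Complex.norm_real,
      Real.norm_of_nonneg (by positivity)]
  have hfin : ∫⁻ s in Ioi (0 : ℝ), (∫⁻ x, ‖k s x‖ₑ) < ⊤ := by
    have : ∀ s ∈ Ioi (0 : ℝ), (∫⁻ x, ‖k s x‖ₑ) =
        ENNReal.ofReal (Real.exp (-s) * s ^ (a - 1)) := by
      intro s hs
      rw [lintegral_congr (hke s hs), lintegral_const_mul' _ _ ENNReal.ofReal_ne_top,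
        lintegral_heatKernel d hs, mul_one]
    rw [setLIntegral_congr_fun measurableSet_Ioi this, lintegral_exp_mul_rpow ha0]
    exact ENNReal.ofReal_lt_top
  obtain ⟨k1, k2, k3⟩ := fourier_integral_superposition hkm hfin
  have hσ : ((Real.Gamma a : ℂ) • besselSymbol d (-β)).HasTemperateGrowth :=
    (Function.HasTemperateGrowth.const (E := Sp d) (Real.Gamma a : ℂ)).mul
      (besselSymbol_hasTemperateGrowth d (-β))
  have key : MultBound ((Real.Gamma a : ℂ) • besselSymbol d (-β)) p q (Real.Gamma (a - κ)) := by
    refine multBound_of_kernel hp hq (r := r) (by linarith) hpq ?_ ?_ hσ k1 k2 ?_ hGκ.le ?_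
    · rw [hr, div_le_iff₀ hy0]
      have : q.toReal * (1 / q.toReal) = 1 := by field_simp
      nlinarith
    · rw [hry]
      linarith
    · funext ξ
      rw [k3]
      have h1 : ∀ s ∈ Ioi (0 : ℝ), 𝓕 (k s) ξ =
          ((Real.exp (-s) * s ^ (a - 1) : ℝ) : ℂ) * heatSymbol d (s + 0) ξ := by
        intro s hs
        have h2 := fourier_const_mul_sub (integrable_ofReal_heatKernel d hs)
          (integrable_ofReal_heatKernel d hs) ((Real.exp (-s) * s ^ (a - 1) : ℝ) : ℂ) 0 ξ
        simp only [zero_mul, sub_zero] at h2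
        rw [add_zero, ← fourier_heatKernel d hs]
        exact h2
      rw [setIntegral_congr_fun measurableSet_Ioi h1, ha,
        integral_exp_mul_rpow_mul_heatSymbol d hβ, heatSymbol_zero, one_mul]
      rfl
    · set w : ℝ → ℝ≥0∞ := fun s => ENNReal.ofReal (Real.exp (-s) * s ^ (a - κ - 1)) with hw
      calc _ ≤ ∫⁻ x, (∫⁻ s in Ioi (0 : ℝ), ‖k s x‖ₑ) ^ r := lintegral_mono fun x =>
            ENNReal.rpow_le_rpow (enorm_integral_le_lintegral_enorm _) (by linarith)
        _ ≤ (∫⁻ s in Ioi (0 : ℝ), w s) ^ r := by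
            refine lintegral_lintegral_rpow_le hr1 hkm.enorm (by fun_prop) ?_
              (ae_of_all _ fun s => ENNReal.ofReal_ne_top) ?_
            · filter_upwards [ae_restrict_mem measurableSet_Ioi] with s hs
              have hs0 : (0 : ℝ) < s := hs
              exact (ENNReal.ofReal_pos.2 (by positivity)).ne'
            · filter_upwards [ae_restrict_mem measurableSet_Ioi] with s hs
              have hs0 : (0 : ℝ) < s := hs
              simp only [hke s hs]
              simp only [ENNReal.mul_rpow_of_nonneg _ _ (zero_le_one.trans hr1)]
              rw [lintegral_const_mul' _ _
                (ENNReal.rpow_ne_top_of_nonneg (by linarith) ENNReal.ofReal_ne_top)]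
              have hw' : w s = ENNReal.ofReal (Real.exp (-s) * s ^ (a - 1)) *
                  ENNReal.ofReal (s ^ (-κ)) := by
                rw [← ENNReal.ofReal_mul (by positivity), mul_assoc, ← Real.rpow_add hs0, hw]
                ring_nf
              rw [hw', ENNReal.mul_rpow_of_nonneg _ _ (by linarith)]
              exact mul_le_mul_right (lintegral_heatKernel_rpow_le d hs0 hr1) _
        _ = _ := by rw [lintegral_exp_mul_rpow hκa]
  have h2 := key.const_smul hσ ((Real.Gamma a : ℂ)⁻¹)
  rw [smul_smul, inv_mul_cancel₀ (by exact_mod_cast hG.ne'), one_smul] at h2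
  exact ⟨_, by positivity, h2⟩

/-- Interpolating between the two branches lets only a power θ of t/s appear below, so that s^{-θ}
stays integrable against s^{a-1}. -/
theorem min_two_le_two_mul_rpow {y θ : ℝ} (hy : 0 ≤ y) (hθ0 : 0 < θ) (hθ1 : θ ≤ 1) :
    min 2 y ≤ 2 * y ^ θ := by
  rcases le_total y 1 with h | h
  · have := Real.rpow_le_rpow_of_exponent_ge' hy h hθ0.le hθ1
    rw [Real.rpow_one] at this
    have h2 := Real.rpow_nonneg hy θ
    exact (min_le_right _ _).trans (by linarith)
  · have := Real.one_le_rpow h hθ0.le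
    exact (min_le_left _ _).trans (by linarith)

/-- Quantitative strong continuity of the heat semigroup on regular functions. -/
theorem exists_multBound_heat_sub_one (d : ℕ) {p : ℝ≥0∞} [Fact (1 ≤ p)] (hp : p ≠ ⊤) {β : ℝ}
    (hβ0 : 0 < β) (hβ2 : β < 2) :
    ∃ C : ℝ, 0 ≤ C ∧ ∀ t : ℝ, 0 ≤ t →
      MultBound (heatSymbol d t * besselSymbol d (-β) - besselSymbol d (-β)) p p
        (C * t ^ (β / 4)) := by
  set a := β / 2 with ha
  have ha0 : 0 < a := by positivity
  have hG : 0 < Real.Gamma a := Real.Gamma_pos_of_pos ha0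
  -- The interpolation power is half of a = β/2, leaving a - β/4 > 0 for the Gamma integral.
  have hθ0 : 0 < β / 4 := by positivity
  have hθa : 0 < a - β / 4 := by simp only [a]; linarith
  have hGθ : 0 < Real.Gamma (a - β / 4) := Real.Gamma_pos_of_pos hθa
  set I : ℝ := 2 * (d : ℝ) ^ (β / 4) * Real.Gamma (a - β / 4) with hI
  have hI0 : 0 ≤ I := by positivity
  refine ⟨(Real.Gamma a)⁻¹ * I, by positivity, fun t ht => ?_⟩
  set σ := heatSymbol d t * besselSymbol d (-β) - besselSymbol d (-β) with hσd
  have hσ : σ.HasTemperateGrowth :=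
    ((heatSymbol_hasTemperateGrowth d ht).mul (besselSymbol_hasTemperateGrowth d (-β))).sub
      (besselSymbol_hasTemperateGrowth d (-β))
  have hσc : ((Real.Gamma a : ℂ) • σ).HasTemperateGrowth :=
    (Function.HasTemperateGrowth.const (E := Sp d) (Real.Gamma a : ℂ)).mul hσ
  -- The difference K_s - K_{s+t}, without extra damping: the factor `Real.exp (-0)` matches the
  -- case u = 0 of the modulus estimate.
  set k : ℝ → Sp d → ℂ := fun s x => ((Real.exp (-s) * s ^ (a - 1) : ℝ) : ℂ) *
    ((heatKernel d s x - Real.exp (-0) * heatKernel d (s + t) x : ℝ) : ℂ) with hk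
  have hkm : Measurable (Function.uncurry k) := by
    have m1 := measurable_heatKernel d
    have m2 : Measurable fun z : ℝ × Sp d => heatKernel d (z.1 + t) z.2 :=
      (measurable_heatKernel d).comp ((measurable_fst.add measurable_const).prodMk measurable_snd)
    simp only [hk, Function.uncurry_def]
    fun_prop
  have key : MultBound ((Real.Gamma a : ℂ) • σ) p p (I * t ^ (β / 4)) := by
    rw [← neg_neg ((Real.Gamma a : ℂ) • σ)]
    -- The kernel difference is earlier time minus later time, so it represents the opposite symbol.
    have hneg : MultBound (-((Real.Gamma a : ℂ) • σ)) p p (I * t ^ (β / 4)) := by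
      refine multBound_of_superposition hp (ν := volume.restrict (Ioi 0)) hkm hσc.neg (fun ξ => ?_)
        (by positivity) ?_
      · have hi : ∀ u : ℝ, 0 ≤ u → IntegrableOn (fun s : ℝ =>
            ((Real.exp (-s) * s ^ (a - 1) : ℝ) : ℂ) * heatSymbol d (s + u) ξ) (Ioi 0) := by
          intro u hu
          have h1 : IntegrableOn (fun s : ℝ => ((Real.exp (-s) * s ^ (a - 1) : ℝ) : ℂ)) (Ioi 0) :=
            (Real.GammaIntegral_convergent ha0).ofReal
          refine Integrable.mono h1 ?_ ?_
          · have : Measurable fun s : ℝ => heatSymbol d (s + u) ξ := by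
              unfold heatSymbol
              fun_prop
            exact h1.aestronglyMeasurable.mul this.aestronglyMeasurable
          · filter_upwards [ae_restrict_mem measurableSet_Ioi] with s hs
            have hs0 : (0 : ℝ) < s := hs
            rw [norm_mul]
            refine mul_le_of_le_one_right (norm_nonneg _) ?_
            rw [heatSymbol, Complex.norm_real, Real.norm_of_nonneg (Real.exp_nonneg _),
              Real.exp_le_one_iff]
            have : 0 ≤ (s + u) * ‖(2 * Real.pi) • ξ‖ ^ 2 := by positivity
            linarith
        have h1 : ∀ s ∈ Ioi (0 : ℝ), 𝓕 (k s) ξ =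
            ((Real.exp (-s) * s ^ (a - 1) : ℝ) : ℂ) * heatSymbol d (s + 0) ξ -
            ((Real.exp (-s) * s ^ (a - 1) : ℝ) : ℂ) * heatSymbol d (s + t) ξ := by
          intro s hs
          have hs0 : (0 : ℝ) < s := hs
          have hts : 0 < s + t := by linarith
          have e : k s = fun x => ((Real.exp (-s) * s ^ (a - 1) : ℝ) : ℂ) * (heatKernel d s x : ℂ) -
              ((Real.exp (-s) * s ^ (a - 1) : ℝ) : ℂ) * (heatKernel d (s + t) x : ℂ) := by
            funext x
            simp only [hk, neg_zero, Real.exp_zero]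
            push_cast
            ring
          rw [e, fourier_const_mul_sub (integrable_ofReal_heatKernel d hs0)
            (integrable_ofReal_heatKernel d hts), fourier_heatKernel d hs0,
            fourier_heatKernel d hts, add_zero]
        rw [setIntegral_congr_fun measurableSet_Ioi h1, integral_sub (hi 0 le_rfl) (hi t ht), ha,
          integral_exp_mul_rpow_mul_heatSymbol d hβ0, integral_exp_mul_rpow_mul_heatSymbol d hβ0,
          heatSymbol_zero]
        simp only [Pi.neg_apply, Pi.smul_apply, Pi.mul_apply, Pi.sub_apply, smul_eq_mul, hσd]
        ring
      · calc _ ≤ ∫⁻ s in Ioi (0 : ℝ), ENNReal.ofReal (2 * (d : ℝ) ^ (β / 4) * t ^ (β / 4)) *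
              ENNReal.ofReal (Real.exp (-s) * s ^ (a - β / 4 - 1)) := by
              refine setLIntegral_mono' measurableSet_Ioi fun s hs => ?_
              have hs0 : (0 : ℝ) < s := hs
              simp only [hk, enorm_mul]
              rw [lintegral_const_mul' _ _ enorm_ne_top, ← ofReal_norm, Complex.norm_real,
                Real.norm_of_nonneg (by positivity)]
              refine (mul_le_mul_right
                (lintegral_enorm_heatKernel_sub_le d hs0 ht le_rfl) _).trans ?_
              rw [← ENNReal.ofReal_mul (by positivity), ← ENNReal.ofReal_mul (by positivity)]
              apply ENNReal.ofReal_le_ofReal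
              have h1 := min_two_le_two_mul_rpow (y := d * (t / s)) (θ := β / 4)
                (by positivity) hθ0 (by linarith)
              have h2 : ((d : ℝ) * (t / s)) ^ (β / 4) =
                  (d : ℝ) ^ (β / 4) * t ^ (β / 4) * s ^ (-(β / 4)) := by
                rw [Real.mul_rpow (by positivity) (by positivity), Real.div_rpow ht hs0.le,
                  Real.rpow_neg hs0.le]
                ring
              rw [mul_zero, zero_add]
              calc _ ≤ Real.exp (-s) * s ^ (a - 1) * (2 * ((d : ℝ) * (t / s)) ^ (β / 4)) := by
                    gcongr
                _ = _ := by
                    rw [h2, show a - β / 4 - 1 = (a - 1) + -(β / 4) by ring, Real.rpow_add hs0]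
                    ring
          _ = _ := by
              rw [lintegral_const_mul' _ _ ENNReal.ofReal_ne_top, lintegral_exp_mul_rpow hθa,
                ← ENNReal.ofReal_mul (by positivity), hI]
              ring_nf
    have := hneg.const_smul hσc.neg (-1)
    simpa using this
  have h2 := key.const_smul hσc ((Real.Gamma a : ℂ)⁻¹)
  rw [smul_smul, inv_mul_cancel₀ (by exact_mod_cast hG.ne'), one_smul] at h2
  convert h2 using 1
  rw [norm_inv, Complex.norm_real, Real.norm_of_nonneg hG.le, mul_assoc]

end QuadraticHeat

end

/-! ### Sobolev spaces as Banach spaces and the heat semigroup on them -/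

noncomputable section

namespace QuadraticHeat

open FourierTransform TemperedDistribution Filter Topology

theorem bessel_bessel (d : ℕ) (s s' : ℝ) (f : 𝓢'(Sp d, ℂ)) :
    bessel d s (bessel d s' f) = bessel d (s' + s) f := by
  rw [bessel, bessel, fourierMultiplierCLM_fourierMultiplierCLM_apply
    (besselSymbol_hasTemperateGrowth d s') (besselSymbol_hasTemperateGrowth d s),
    besselSymbol_mul, bessel]

theorem bessel_zero (d : ℕ) (f : 𝓢'(Sp d, ℂ)) : bessel d 0 f = f := by
  rw [bessel, besselSymbol_zero]
  simp

theorem bessel_neg_bessel (d : ℕ) (s : ℝ) (f : 𝓢'(Sp d, ℂ)) :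
    bessel d (-s) (bessel d s f) = f := by
  rw [bessel_bessel, add_neg_cancel, bessel_zero]

theorem bessel_bessel_neg (d : ℕ) (s : ℝ) (f : 𝓢'(Sp d, ℂ)) :
    bessel d s (bessel d (-s) f) = f := by
  rw [bessel_bessel, neg_add_cancel, bessel_zero]

theorem heat_heat (d : ℕ) {t s : ℝ} (ht : 0 ≤ t) (hs : 0 ≤ s) (f : 𝓢'(Sp d, ℂ)) :
    heat d t (heat d s f) = heat d (t + s) f := by
  rw [heat, heat, fourierMultiplierCLM_fourierMultiplierCLM_apply
    (heatSymbol_hasTemperateGrowth d hs) (heatSymbol_hasTemperateGrowth d ht),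
    heatSymbol_mul, add_comm, heat]

theorem bessel_fourierMultiplierCLM (d : ℕ) (s : ℝ) {σ : Sp d → ℂ} (hσ : σ.HasTemperateGrowth)
    (f : 𝓢'(Sp d, ℂ)) :
    bessel d s (fourierMultiplierCLM ℂ σ f) = fourierMultiplierCLM ℂ σ (bessel d s f) := by
  rw [bessel, fourierMultiplierCLM_fourierMultiplierCLM_apply hσ
      (besselSymbol_hasTemperateGrowth d s), fourierMultiplierCLM_fourierMultiplierCLM_apply
      (besselSymbol_hasTemperateGrowth d s) hσ, mul_comm]

namespace SobolevSpace

variable {d : ℕ} {s : ℝ} {p : ℝ≥0∞} [Fact (1 ≤ p)]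

theorem toDistribution_injective :
    Function.Injective (toDistribution : SobolevSpace d s p →ₗ[ℂ] 𝓢'(Sp d, ℂ)) :=
  Subtype.val_injective

theorem toLp_surjective : Function.Surjective (toLp : SobolevSpace d s p →ₗ[ℂ] _) := by
  intro g
  have h : bessel d s (bessel d (-s) (lpEmbed d p g)) = lpEmbed d p g := bessel_bessel_neg d s _
  let f : SobolevSpace d s p := ⟨bessel d (-s) (lpEmbed d p g), ⟨g, h.symm⟩⟩
  refine ⟨f, lpEmbed_injective d p ?_⟩
  rw [lpEmbed_toLp]
  exact h

/-- The isometry `(1 - Δ)^{s/2}` from `W^{s,p}` onto `L^p`. -/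
def lpEquiv (d : ℕ) (s : ℝ) (p : ℝ≥0∞) [Fact (1 ≤ p)] :
    SobolevSpace d s p ≃ₗᵢ[ℂ] Lp ℂ p (volume : Measure (Sp d)) where
  toLinearEquiv := LinearEquiv.ofBijective toLp ⟨toLp_injective, toLp_surjective⟩
  norm_map' _ := rfl

theorem lpEmbed_lpEquiv (f : SobolevSpace d s p) :
    lpEmbed d p (lpEquiv d s p f) = bessel d s (toDistribution f) :=
  lpEmbed_toLp f

theorem bessel_toDistribution_symm (g : Lp ℂ p (volume : Measure (Sp d))) :
    bessel d s (toDistribution ((lpEquiv d s p).symm g)) = lpEmbed d p g := by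
  rw [← lpEmbed_lpEquiv, LinearIsometryEquiv.apply_symm_apply]

instance : CompleteSpace (SobolevSpace d s p) :=
  (completeSpace_congr (e := (lpEquiv d s p).toEquiv) (lpEquiv d s p).isometry.isUniformEmbedding).2
    inferInstance

end SobolevSpace

open SobolevSpace

/-- A multiplier `σ` such that `σ (1 + |·|²)^{s/2}` is bounded from `L^m` to `L^p` maps `L^m` to
`W^{s,p}`. -/
theorem MultBound.exists_clm_sobolev {d : ℕ} {s : ℝ} {σ : Sp d → ℂ} {m p : ℝ≥0∞} [Fact (1 ≤ m)]
    [Fact (1 ≤ p)] {A : ℝ} (hA : 0 ≤ A) (hσ : σ.HasTemperateGrowth)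
    (h : MultBound (σ * besselSymbol d s) m p A) :
    ∃ S : Lp ℂ m (volume : Measure (Sp d)) →L[ℂ] SobolevSpace d s p,
      (∀ f, toDistribution (S f) = fourierMultiplierCLM ℂ σ (lpEmbed d m f)) ∧ ‖S‖ ≤ A := by
  obtain ⟨T, hT, hTn⟩ := h.exists_clm hA
  refine ⟨(lpEquiv d s p).symm.toContinuousLinearEquiv.toContinuousLinearMap ∘L T,
    fun f => ?_, ?_⟩
  · apply bessel_injective d s
    refine (bessel_toDistribution_symm (T f)).trans ?_
    rw [hT, bessel, fourierMultiplierCLM_fourierMultiplierCLM_apply hσ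
      (besselSymbol_hasTemperateGrowth d s)]
  · refine ContinuousLinearMap.opNorm_le_bound _ hA fun f => ?_
    refine le_trans (le_of_eq ?_) (T.le_of_opNorm_le hTn f)
    exact (lpEquiv d s p).symm.norm_map (T f)

/-- The Sobolev embedding as a continuous linear map. -/
theorem exists_clm_sobolev_lp (d : ℕ) {p q : ℝ≥0∞} [Fact (1 ≤ p)] [Fact (1 ≤ q)]
    (hp : p ≠ ⊤) (hq : q ≠ ⊤) (hpq : p.toReal ≤ q.toReal) {β : ℝ} (hβ : 0 < β)
    (h : d * (1 / p.toReal - 1 / q.toReal) < β) :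
    ∃ J : SobolevSpace d β p →L[ℂ] Lp ℂ q (volume : Measure (Sp d)),
      ∀ v, lpEmbed d q (J v) = toDistribution v := by
  obtain ⟨A, hA, hm⟩ := exists_multBound_bessel_neg d hp hq hpq hβ h
  obtain ⟨T, hT, -⟩ := hm.exists_clm hA
  refine ⟨T ∘L (lpEquiv d β p).toContinuousLinearEquiv.toContinuousLinearMap, fun v => ?_⟩
  refine (hT _).trans ?_
  change bessel d (-β) (lpEmbed d p (lpEquiv d β p v)) = _
  rw [lpEmbed_lpEquiv, bessel_neg_bessel]

/-- A contraction semigroup that is strongly continuous at `0` on a dense set is strongly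
continuous. -/
theorem continuousOn_semigroup {E : Type*} [NormedAddCommGroup E] [NormedSpace ℂ E]
    {T : ℝ → E →L[ℂ] E} (hT : ∀ t, 0 ≤ t → ‖T t‖ ≤ 1)
    (hadd : ∀ t s, 0 ≤ t → 0 ≤ s → ∀ f, T (t + s) f = T t (T s f)) {D : Set E} (hD : Dense D)
    (h0 : ∀ f ∈ D, Tendsto (fun t => T t f) (𝓝[≥] 0) (𝓝 f)) (f : E) :
    ContinuousOn (fun t => T t f) (Ici 0) := by
  have hle : ∀ t, 0 ≤ t → ∀ f, ‖T t f‖ ≤ ‖f‖ := fun t ht f => by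
    simpa using (T t).le_of_opNorm_le (hT t ht) f
  have h1 : ∀ ε > 0, ∃ δ > 0, ∀ t, 0 ≤ t → t < δ → ‖T t f - f‖ < ε := by
    intro ε hε
    obtain ⟨g, hg, hfg⟩ := hD.exists_dist_lt f (show 0 < ε / 3 by positivity)
    obtain ⟨δ, hδ, hδ'⟩ := Metric.tendsto_nhdsWithin_nhds.1 (h0 g hg) (ε / 3) (by positivity)
    refine ⟨δ, hδ, fun t ht htδ => ?_⟩
    have e1 : ‖T t g - g‖ < ε / 3 := by
      rw [← dist_eq_norm]
      exact hδ' ht (by rwa [Real.dist_eq, sub_zero, abs_of_nonneg ht])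
    have e2 : ‖T t (f - g)‖ < ε / 3 := (hle t ht _).trans_lt (by rwa [← dist_eq_norm])
    have e3 : ‖f - g‖ < ε / 3 := by rwa [← dist_eq_norm]
    have e4 : T t f - f = T t (f - g) + (T t g - g) - (f - g) := by
      rw [map_sub]
      abel
    rw [e4]
    calc _ ≤ ‖T t (f - g)‖ + ‖T t g - g‖ + ‖f - g‖ :=
          (norm_sub_le _ _).trans (add_le_add_left (norm_add_le _ _) _)
      _ < ε := by linarith
  -- By contractivity every increment is controlled by one starting at time 0, which gives
  -- continuity from both sides.
  have h2 : ∀ t s, 0 ≤ t → t ≤ s → ‖T s f - T t f‖ ≤ ‖T (s - t) f - f‖ := by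
    intro t s ht hts
    have : T s f = T t (T (s - t) f) := by
      rw [← hadd t (s - t) ht (by linarith), add_sub_cancel]
    rw [this, ← map_sub]
    exact hle t ht _
  rw [Metric.continuousOn_iff]
  intro t ht ε hε
  obtain ⟨δ, hδ, hδ'⟩ := h1 ε hε
  refine ⟨δ, hδ, fun s hs hst => ?_⟩
  rw [dist_eq_norm]
  rw [Real.dist_eq] at hst
  rcases le_total t s with h | h
  · rw [abs_of_nonneg (by linarith)] at hst
    exact (h2 t s ht h).trans_lt (hδ' _ (by linarith) hst)
  · rw [norm_sub_rev]
    rw [abs_of_nonpos (by linarith)] at hst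
    exact (h2 s t hs h).trans_lt (hδ' _ (by linarith) (by linarith))

/-- The heat semigroup on `L^p`. -/
theorem exists_heat_lp (d : ℕ) {p : ℝ≥0∞} [Fact (1 ≤ p)] (hp : p ≠ ⊤) :
    ∃ T : ℝ → Lp ℂ p (volume : Measure (Sp d)) →L[ℂ] Lp ℂ p (volume : Measure (Sp d)),
      (∀ t, 0 ≤ t → ∀ f, lpEmbed d p (T t f) = heat d t (lpEmbed d p f)) ∧
      (∀ t, 0 ≤ t → ‖T t‖ ≤ 1) ∧ ∀ f, ContinuousOn (fun t => T t f) (Ici 0) := by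
  have h : ∀ t : ℝ, ∃ T : Lp ℂ p (volume : Measure (Sp d)) →L[ℂ] Lp ℂ p (volume : Measure (Sp d)),
      0 ≤ t → (∀ f, lpEmbed d p (T f) = heat d t (lpEmbed d p f)) ∧ ‖T‖ ≤ 1 := by
    intro t
    by_cases ht : 0 ≤ t
    · obtain ⟨T, h1, h2⟩ := (multBound_heat_self d hp ht).exists_clm zero_le_one
      exact ⟨T, fun _ => ⟨h1, h2⟩⟩
    · exact ⟨0, fun h => absurd h ht⟩
  choose T hT using h
  refine ⟨T, fun t ht => (hT t ht).1, fun t ht => (hT t ht).2, ?_⟩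
  refine continuousOn_semigroup (fun t ht => (hT t ht).2) (fun t s ht hs f => ?_)
    (SchwartzMap.denseRange_toLpCLM (E := Sp d) (F := ℂ) (p := p) (μ := volume) hp) ?_
  · apply lpEmbed_injective d p
    rw [(hT _ (add_nonneg ht hs)).1, (hT t ht).1, (hT s hs).1, heat_heat d ht hs]
  · rintro - ⟨f, rfl⟩
    obtain ⟨C, hC, hb⟩ := exists_multBound_heat_sub_one d hp zero_lt_one one_lt_two
    -- A Schwartz function is f = (1 - Δ)^{-1/2} g with g Schwartz, so the case β = 1 gives ‖e^{tΔ}f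
    -- - f‖ ≤ C t^{1/4} ‖g‖.
    set g := SchwartzMap.fourierMultiplierCLM ℂ (besselSymbol d 1) f
    have hfd : lpEmbed d p (SchwartzMap.toLpCLM ℝ ℂ p volume f) =
        bessel d (-1) (lpEmbed d p (g.toLp p)) := by
      have e : ∀ u : 𝓢(Sp d, ℂ), lpEmbed d p (u.toLp p) =
          SchwartzMap.toTemperedDistributionCLM (Sp d) ℂ volume u :=
        fun u => Lp.toTemperedDistribution_toLp_eq u
      rw [SchwartzMap.toLpCLM_apply, e, e, ← fourierMultiplierCLM_toTemperedDistributionCLM_eq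
        (besselSymbol_hasTemperateGrowth d 1)]
      exact (bessel_neg_bessel d 1 _).symm
    set F := SchwartzMap.toLpCLM ℝ ℂ p volume f
    rw [tendsto_iff_norm_sub_tendsto_zero]
    have hlim : Tendsto (fun t : ℝ => C * t ^ (1 / 4 : ℝ) * ‖g.toLp p (volume : Measure (Sp d))‖)
        (𝓝[≥] 0) (𝓝 0) := by
      have : Continuous fun t : ℝ =>
          C * t ^ (1 / 4 : ℝ) * ‖g.toLp p (volume : Measure (Sp d))‖ := by
        have := Real.continuous_rpow_const (q := 1 / 4) (by norm_num)
        fun_prop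
      have h0 := this.tendsto 0
      rw [Real.zero_rpow (by norm_num), mul_zero, zero_mul] at h0
      exact h0.mono_left nhdsWithin_le_nhds
    refine squeeze_zero' (Eventually.of_forall fun _ => norm_nonneg _) ?_ hlim
    filter_upwards [self_mem_nhdsWithin] with t ht
    obtain ⟨u, hu, hun⟩ := hb t ht (g.toLp p)
    have : T t F - F = u := by
      apply lpEmbed_injective d p
      rw [map_sub, (hT t ht).1, hu, hfd]
      have hs : fourierMultiplierCLM ℂ
          (heatSymbol d t * besselSymbol d (-1) - besselSymbol d (-1)) =
          fourierMultiplierCLM ℂ (heatSymbol d t * besselSymbol d (-1)) -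
            fourierMultiplierCLM ℂ (besselSymbol d (-1)) := by
        ext1 v
        rw [fourierMultiplierCLM_apply, smulLeftCLM_sub
          ((heatSymbol_hasTemperateGrowth d ht).mul (besselSymbol_hasTemperateGrowth d (-1)))
          (besselSymbol_hasTemperateGrowth d (-1))]
        exact map_sub (fourierInvCLM ℂ 𝓢'(Sp d, ℂ)) _ _
      rw [hs, bessel, heat, fourierMultiplierCLM_fourierMultiplierCLM_apply
        (besselSymbol_hasTemperateGrowth d (-1)) (heatSymbol_hasTemperateGrowth d ht), mul_comm]
      rfl
    rw [this]
    exact hun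

/-- The heat semigroup on `W^{s,p}`. -/
theorem exists_heat_sobolev (d : ℕ) (s : ℝ) {p : ℝ≥0∞} [Fact (1 ≤ p)] (hp : p ≠ ⊤) :
    ∃ U : ℝ → SobolevSpace d s p →L[ℂ] SobolevSpace d s p,
      (∀ t, 0 ≤ t → ∀ v, toDistribution (U t v) = heat d t (toDistribution v)) ∧
      (∀ t, 0 ≤ t → ‖U t‖ ≤ 1) ∧ ∀ v, ContinuousOn (fun t => U t v) (Ici 0) := by
  obtain ⟨T, hT, hTn, hTc⟩ := exists_heat_lp d hp
  set e := lpEquiv d s p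
  refine ⟨fun t => e.symm.toContinuousLinearEquiv.toContinuousLinearMap ∘L T t ∘L
    e.toContinuousLinearEquiv.toContinuousLinearMap, fun t ht v => ?_, fun t ht => ?_, fun v => ?_⟩
  · apply bessel_injective d s
    refine (bessel_toDistribution_symm _).trans ?_
    refine (hT t ht _).trans ?_
    change heat d t (lpEmbed d p (lpEquiv d s p v)) = _
    rw [lpEmbed_lpEquiv, heat, bessel_fourierMultiplierCLM _ _ (heatSymbol_hasTemperateGrowth d ht)]
  · refine ContinuousLinearMap.opNorm_le_bound _ zero_le_one fun v => ?_
    refine (le_of_eq (e.symm.norm_map (T t (e v)))).trans ?_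
    refine ((T t).le_of_opNorm_le (hTn t ht) _).trans (le_of_eq ?_)
    rw [e.norm_map]
  · exact e.symm.continuous.comp_continuousOn (hTc (e v))

/-- The heat semigroup from `L^m` to `W^{β,p}`. -/
theorem exists_heat_lp_sobolev (d : ℕ) {m p : ℝ≥0∞} [Fact (1 ≤ m)] [Fact (1 ≤ p)] (hm : m ≠ ⊤)
    (hp : p ≠ ⊤) (hmp : m.toReal ≤ p.toReal) {β : ℝ} (hβ0 : 0 < β) (hβ2 : β < 2) :
    ∃ C : ℝ, 0 ≤ C ∧
      ∃ S : ℝ → Lp ℂ m (volume : Measure (Sp d)) →L[ℂ] SobolevSpace d β p,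
        (∀ t, 0 < t → ∀ g, toDistribution (S t g) = heat d t (lpEmbed d m g)) ∧
        (∀ t, 0 < t → t ≤ 1 →
          ‖S t‖ ≤ C * t ^ (-(β / 2 + d / 2 * (1 / m.toReal - 1 / p.toReal)))) ∧
        ∀ g, ContinuousOn (fun t => S t g) (Ioi 0) := by
  obtain ⟨U, hU, -, hUc⟩ := exists_heat_sobolev d β hp
  obtain ⟨C, hC, hb⟩ := exists_multBound_heat_mul_bessel d hp hβ0 hβ2
  set κ := d / 2 * (1 / m.toReal - 1 / p.toReal) with hκ
  -- Half of the time is spent passing from L^m to L^p, the other half gaining β derivatives.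
  have hmb : ∀ t : ℝ, 0 < t → t ≤ 1 → MultBound (heatSymbol d t * besselSymbol d β) m p
      (C * 2 ^ (β / 2 + κ) * t ^ (-(β / 2 + κ))) := by
    intro t ht ht1
    have ht2 : 0 < t / 2 := by positivity
    have := (multBound_heat d hm hp hmp ht2).comp (heatSymbol_hasTemperateGrowth d ht2.le)
      ((heatSymbol_hasTemperateGrowth d ht2.le).mul (besselSymbol_hasTemperateGrowth d β))
      (by positivity) (hb (t / 2) ht2 (by linarith))
    rw [← mul_assoc, heatSymbol_mul, add_halves, mul_assoc, ← Real.rpow_add ht2] at this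
    refine this.mono (le_of_eq ?_)
    rw [← hκ, ← neg_add, Real.div_rpow ht.le zero_le_two, mul_assoc, Real.rpow_neg zero_le_two]
    field_simp
  have h1 : ∀ t : ℝ, ∃ S : Lp ℂ m (volume : Measure (Sp d)) →L[ℂ] SobolevSpace d β p,
      0 < t → (∀ g, toDistribution (S g) = heat d t (lpEmbed d m g)) ∧
        (t ≤ 1 → ‖S‖ ≤ C * 2 ^ (β / 2 + κ) * t ^ (-(β / 2 + κ))) := by
    intro t
    rcases le_or_gt t 0 with ht | ht
    · exact ⟨0, fun h => absurd h ht.not_gt⟩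
    · rcases le_or_gt t 1 with ht1 | ht1
      · obtain ⟨S, hS, hSn⟩ := (hmb t ht ht1).exists_clm_sobolev (by positivity)
          (heatSymbol_hasTemperateGrowth d ht.le)
        exact ⟨S, fun _ => ⟨hS, fun _ => hSn⟩⟩
      · obtain ⟨S, hS, -⟩ := (hmb 1 one_pos le_rfl).exists_clm_sobolev (by positivity)
          (heatSymbol_hasTemperateGrowth d zero_le_one)
        -- Beyond time 1 no bound is claimed, so the time-1 operator is followed by the semigroup.
        refine ⟨U (t - 1) ∘L S, fun _ => ⟨fun g => ?_, fun h => absurd h ht1.not_ge⟩⟩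
        have ht0 : 0 ≤ t - 1 := by linarith
        refine (hU _ ht0 _).trans ?_
        refine (congrArg _ (hS g)).trans ?_
        refine (heat_heat d ht0 zero_le_one _).trans ?_
        rw [sub_add_cancel]
  choose S hS using h1
  refine ⟨C * 2 ^ (β / 2 + κ), by positivity, S, fun t ht => (hS t ht).1,
    fun t ht => (hS t ht).2, fun g t ht => ?_⟩
  have ht' : (0 : ℝ) < t := ht
  have ht2 : 0 < t / 2 := by positivity
  -- After time t/2 the orbit is a semigroup orbit in W^{β,p}, and strong continuity of U applies.
  have e : ∀ r ∈ Ici (t / 2), S r g = U (r - t / 2) (S (t / 2) g) := by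
    intro r hr
    have hr' : t / 2 ≤ r := hr
    have h0 : 0 ≤ r - t / 2 := by linarith
    apply toDistribution_injective
    rw [(hS r (by linarith)).1, hU _ h0, (hS _ ht2).1, heat_heat d h0 ht2.le, sub_add_cancel]
  have hc : ContinuousOn (fun r => U (r - t / 2) (S (t / 2) g)) (Ici (t / 2)) :=
    (hUc _).comp (by fun_prop) fun r hr => mem_Ici.2 (sub_nonneg.2 hr)
  have hc' : ContinuousOn (fun r => S r g) (Ici (t / 2)) := hc.congr e
  exact (hc'.continuousAt (Ici_mem_nhds (by linarith))).continuousWithinAt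

end QuadraticHeat

end

/-! ### Duhamel integrals with an integrable singularity -/

noncomputable section

namespace QuadraticHeat

open Filter Topology

section Duhamel

variable {W Y : Type*} [NormedAddCommGroup W] [NormedSpace ℂ W] [NormedAddCommGroup Y]
  [NormedSpace ℂ Y] {S : ℝ → Y →L[ℂ] W} {C γ : ℝ}

/-- The Duhamel integral `∫_0^t S(t-τ) N(τ) dτ`. -/
def duhamel (S : ℝ → Y →L[ℂ] W) (N : ℝ → Y) (t : ℝ) : W :=
  ∫ τ in (0 : ℝ)..t, S (t - τ) (N τ)

/-- Time reversal moves the singularity from the variable endpoint t to the fixed endpoint 0. -/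
theorem duhamel_eq (S : ℝ → Y →L[ℂ] W) (N : ℝ → Y) (t : ℝ) :
    duhamel S N t = ∫ τ in (0 : ℝ)..t, S τ (N (t - τ)) := by
  have := intervalIntegral.integral_comp_sub_left (a := 0) (b := t)
    (fun τ => S τ (N (t - τ))) t
  simp only [sub_sub_cancel, sub_self, sub_zero] at this
  exact this

/-- Split S_t N_t = S_t N_{t₀} + S_t(N_t - N_{t₀}): strong continuity handles the first term, the
locally bounded operator norm the second. -/
theorem continuousOn_apply_of_singular (hS : ∀ t, 0 < t → t ≤ 1 → ‖S t‖ ≤ C * t ^ (-γ))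
    (hSc : ∀ y, ContinuousOn (fun t => S t y) (Ioi 0)) {N : ℝ → Y} (hN : Continuous N) :
    ContinuousOn (fun t => S t (N t)) (Ioc 0 1) := by
  intro t₀ ht₀
  have h1 : Tendsto (fun t => S t (N t₀)) (𝓝[Ioc 0 1] t₀) (𝓝 (S t₀ (N t₀))) :=
    ((hSc (N t₀)).mono Ioc_subset_Ioi_self) t₀ ht₀
  have h2 : Tendsto (fun t => S t (N t - N t₀)) (𝓝[Ioc 0 1] t₀) (𝓝 0) := by
    have hc : ContinuousAt (fun t => C * t ^ (-γ) * ‖N t - N t₀‖) t₀ := by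
      have : ContinuousAt (fun t : ℝ => t ^ (-γ)) t₀ :=
        Real.continuousAt_rpow_const _ _ (Or.inl ht₀.1.ne')
      have h3 := hN.continuousAt (x := t₀)
      fun_prop
    have h0 : Tendsto (fun t => C * t ^ (-γ) * ‖N t - N t₀‖) (𝓝[Ioc 0 1] t₀) (𝓝 0) := by
      have := hc.tendsto.mono_left (nhdsWithin_le_nhds (s := Ioc 0 1))
      simpa using this
    refine squeeze_zero_norm' ?_ h0
    filter_upwards [self_mem_nhdsWithin] with t ht
    exact (S t).le_of_opNorm_le (hS t ht.1 ht.2) _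
  have h3 := h1.add h2
  rw [add_zero] at h3
  refine h3.congr fun t => ?_
  rw [← map_add, add_sub_cancel]

theorem intervalIntegrable_singular (hγ : γ < 1)
    (hS : ∀ t, 0 < t → t ≤ 1 → ‖S t‖ ≤ C * t ^ (-γ))
    (hSc : ∀ y, ContinuousOn (fun t => S t y) (Ioi 0)) {N : ℝ → Y} (hN : Continuous N) {t : ℝ}
    (ht0 : 0 ≤ t) (ht1 : t ≤ 1) : IntervalIntegrable (fun τ => S τ (N τ)) volume 0 t := by
  obtain ⟨B, hB⟩ := (isCompact_Icc (a := (0 : ℝ)) (b := t)).exists_bound_of_continuousOn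
    hN.continuousOn
  rw [intervalIntegrable_iff_integrableOn_Ioc_of_le ht0]
  have hi : IntegrableOn (fun τ : ℝ => C * B * τ ^ (-γ)) (Ioc 0 t) :=
    ((intervalIntegrable_iff_integrableOn_Ioc_of_le ht0).1
      (intervalIntegral.intervalIntegrable_rpow' (by linarith))).const_mul _
  refine hi.mono' (((continuousOn_apply_of_singular hS hSc hN).mono
    (Ioc_subset_Ioc_right ht1)).aestronglyMeasurable measurableSet_Ioc) ?_
  filter_upwards [ae_restrict_mem measurableSet_Ioc] with τ hτ
  have h1 := hS τ hτ.1 (hτ.2.trans ht1)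
  calc _ ≤ ‖S τ‖ * ‖N τ‖ := (S τ).le_opNorm _
    _ ≤ C * τ ^ (-γ) * B := mul_le_mul h1 (hB τ ⟨hτ.1.le, hτ.2⟩) (norm_nonneg _)
        ((norm_nonneg _).trans h1)
    _ = _ := by ring

theorem intervalIntegrable_duhamel (hγ : γ < 1)
    (hS : ∀ t, 0 < t → t ≤ 1 → ‖S t‖ ≤ C * t ^ (-γ))
    (hSc : ∀ y, ContinuousOn (fun t => S t y) (Ioi 0)) {N : ℝ → Y} (hN : Continuous N) {t : ℝ}
    (ht0 : 0 ≤ t) (ht1 : t ≤ 1) : IntervalIntegrable (fun τ => S (t - τ) (N τ)) volume 0 t := by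
  have h := (intervalIntegrable_singular hγ hS hSc (N := fun τ => N (t - τ)) (by fun_prop)
    ht0 ht1).comp_sub_left t
  simp only [sub_sub_cancel, sub_zero, sub_self] at h
  exact h.symm

/-- The integral of τ^{-γ} over [0,t] is t^{1-γ}/(1-γ). The bound on N is needed only strictly
before t, which is what the first-exit argument provides. -/
theorem norm_duhamel_le (hγ : γ < 1)
    (hS : ∀ t, 0 < t → t ≤ 1 → ‖S t‖ ≤ C * t ^ (-γ)) {N : ℝ → Y} {t b : ℝ}
    (ht0 : 0 ≤ t) (ht1 : t ≤ 1) (hb : ∀ τ, 0 ≤ τ → τ < t → ‖N τ‖ ≤ b) :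
    ‖duhamel S N t‖ ≤ C / (1 - γ) * t ^ (1 - γ) * b := by
  have hi : IntervalIntegrable (fun τ : ℝ => C * b * τ ^ (-γ)) volume 0 t :=
    (intervalIntegral.intervalIntegrable_rpow' (by linarith)).const_mul _
  rw [duhamel_eq]
  refine (intervalIntegral.norm_integral_le_of_norm_le ht0 (ae_of_all _ fun τ hτ => ?_) hi).trans
    (le_of_eq ?_)
  · have h1 := hS τ hτ.1 (hτ.2.trans ht1)
    calc _ ≤ ‖S τ‖ * ‖N (t - τ)‖ := (S τ).le_opNorm _
      _ ≤ C * τ ^ (-γ) * b := mul_le_mul h1 (hb _ (by linarith [hτ.2]) (by linarith [hτ.1]))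
          (norm_nonneg _) ((norm_nonneg _).trans h1)
      _ = _ := by ring
  · rw [intervalIntegral.integral_const_mul, integral_rpow (Or.inl (by linarith)),
      Real.zero_rpow (by linarith), neg_add_eq_sub]
    ring

theorem duhamel_sub (hγ : γ < 1)
    (hS : ∀ t, 0 < t → t ≤ 1 → ‖S t‖ ≤ C * t ^ (-γ))
    (hSc : ∀ y, ContinuousOn (fun t => S t y) (Ioi 0)) {N₁ N₂ : ℝ → Y} (hN₁ : Continuous N₁)
    (hN₂ : Continuous N₂) {t : ℝ} (ht0 : 0 ≤ t) (ht1 : t ≤ 1) :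
    duhamel S (fun τ => N₁ τ - N₂ τ) t = duhamel S N₁ t - duhamel S N₂ t := by
  unfold duhamel
  rw [← intervalIntegral.integral_sub (intervalIntegrable_duhamel hγ hS hSc hN₁ ht0 ht1)
    (intervalIntegrable_duhamel hγ hS hSc hN₂ ht0 ht1)]
  simp only [map_sub]

theorem continuousOn_duhamel (hγ : γ < 1)
    (hS : ∀ t, 0 < t → t ≤ 1 → ‖S t‖ ≤ C * t ^ (-γ))
    (hSc : ∀ y, ContinuousOn (fun t => S t y) (Ioi 0)) {N : ℝ → Y} (hN : Continuous N) {B : ℝ}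
    (hB : ∀ τ, ‖N τ‖ ≤ B) : ContinuousOn (duhamel S N) (Icc 0 1) := by
  -- The variable upper limit becomes an indicator on the fixed interval [0,1], so that dominated
  -- convergence applies with the majorant C B τ^{-γ}.
  set F : ℝ → ℝ → W := fun t => (Iio t).indicator fun τ => S τ (N (t - τ)) with hF
  have e : ∀ t ∈ Icc (0 : ℝ) 1, duhamel S N t = ∫ τ in (0 : ℝ)..1, F t τ := by
    intro t ht
    rw [duhamel_eq, intervalIntegral.integral_of_le ht.1, intervalIntegral.integral_of_le zero_le_one,
      hF, integral_indicator measurableSet_Iio, Measure.restrict_restrict measurableSet_Iio]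
    apply setIntegral_congr_set
    have : Iio t ∩ Ioc 0 1 = Ioo 0 t := by
      ext τ
      simp only [mem_inter_iff, mem_Iio, mem_Ioc, mem_Ioo]
      exact ⟨fun h => ⟨h.2.1, h.1⟩, fun h => ⟨h.2, h.1, h.2.le.trans ht.2⟩⟩
    rw [this]
    exact Ioo_ae_eq_Ioc.symm
  refine ContinuousOn.congr (fun t ht => ?_) e
  refine ContinuousAt.continuousWithinAt ?_
  refine intervalIntegral.continuousAt_of_dominated_interval (F := F)
    (bound := fun τ => C * B * τ ^ (-γ)) (Eventually.of_forall fun s => ?_)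
    (Eventually.of_forall fun s => ae_of_all _ fun τ hτ => ?_)
    ((intervalIntegral.intervalIntegrable_rpow' (by linarith)).const_mul _) ?_
  · rw [uIoc_of_le zero_le_one]
    exact ((continuousOn_apply_of_singular hS hSc (N := fun τ => N (s - τ))
      (by fun_prop)).aestronglyMeasurable measurableSet_Ioc).indicator measurableSet_Iio
  · rw [uIoc_of_le zero_le_one] at hτ
    refine (norm_indicator_le_norm_self _ _).trans ?_
    have h1 := hS τ hτ.1 hτ.2
    calc _ ≤ ‖S τ‖ * ‖N (s - τ)‖ := (S τ).le_opNorm _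
      _ ≤ C * τ ^ (-γ) * B := mul_le_mul h1 (hB _) (norm_nonneg _) ((norm_nonneg _).trans h1)
      _ = _ := by ring
  -- The indicator jumps only when the parameter passes τ, so the null set τ = t is the only
  -- exception.
  · have : ∀ᵐ τ : ℝ ∂volume, τ ≠ t := by simp [ae_iff]
    filter_upwards [this] with τ hτ _
    rcases lt_or_gt_of_ne hτ with h | h
    · have hc : ContinuousAt (fun s => S τ (N (s - τ))) t := by fun_prop
      refine hc.congr ?_
      filter_upwards [lt_mem_nhds h] with s hs
      simp only [hF]
      rw [indicator_of_mem (mem_Iio.2 hs)]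
    · refine (continuousAt_const (y := (0 : W))).congr ?_
      filter_upwards [gt_mem_nhds h] with s hs
      simp only [hF]
      rw [indicator_of_notMem (by simpa using hs.le)]

end Duhamel

end QuadraticHeat

end

/-! ### The abstract quadratic fixed-point problem -/

noncomputable section

namespace QuadraticHeat

open Filter Topology

section FixedPoint

variable {W Y Z : Type*} [NormedAddCommGroup W] [NormedSpace ℂ W] [NormedAddCommGroup Y]
  [NormedSpace ℂ Y] [NormedAddCommGroup Z] [NormedSpace ℂ Z]

/-- The nonlinearity `(A₁ v + A₂ Ψ)²`, extended to all times by projection to `[0,T]`. -/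
def quadratic (mul : Z →L[ℂ] Z →L[ℂ] Y) (A₁ A₂ : W →L[ℂ] Z) {T : ℝ} (hT : 0 ≤ T)
    (Ψ v : C(Icc (0 : ℝ) T, W)) (τ : ℝ) : Y :=
  mul (A₁ (v (projIcc 0 T hT τ)) + A₂ (Ψ (projIcc 0 T hT τ)))
    (A₁ (v (projIcc 0 T hT τ)) + A₂ (Ψ (projIcc 0 T hT τ)))

theorem continuous_quadratic (mul : Z →L[ℂ] Z →L[ℂ] Y) (A₁ A₂ : W →L[ℂ] Z) {T : ℝ} (hT : 0 ≤ T)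
    (Ψ v : C(Icc (0 : ℝ) T, W)) : Continuous (quadratic mul A₁ A₂ hT Ψ v) := by
  have h1 : Continuous fun τ => v (projIcc 0 T hT τ) := v.continuous.comp continuous_projIcc
  have h2 : Continuous fun τ => Ψ (projIcc 0 T hT τ) := Ψ.continuous.comp continuous_projIcc
  unfold quadratic
  fun_prop

theorem continuous_mul_apply (mul : Z →L[ℂ] Z →L[ℂ] Y) {f g : ℝ → Z} (hf : Continuous f)
    (hg : Continuous g) : Continuous fun τ => mul (f τ) (g τ) :=
  (mul.continuous.comp hf).clm_apply hg

/-- Expanding the square turns the three integrals of the equation into one; symmetry of the product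
merges the cross terms into the factor 2. -/
theorem duhamel_quadratic {S : ℝ → Y →L[ℂ] W} {C γ : ℝ} (hγ : γ < 1)
    (hS : ∀ t, 0 < t → t ≤ 1 → ‖S t‖ ≤ C * t ^ (-γ))
    (hSc : ∀ y, ContinuousOn (fun t => S t y) (Ioi 0)) {mul : Z →L[ℂ] Z →L[ℂ] Y}
    (hmul : ∀ x y, mul x y = mul y x) (A₁ A₂ : W →L[ℂ] Z) {T : ℝ} (hT : 0 ≤ T)
    (Ψ v : C(Icc (0 : ℝ) T, W)) {t : ℝ} (ht0 : 0 ≤ t) (ht1 : t ≤ 1) :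
    duhamel S (quadratic mul A₁ A₂ hT Ψ v) t =
      duhamel S (fun τ => mul (A₁ (v (projIcc 0 T hT τ))) (A₁ (v (projIcc 0 T hT τ)))) t +
      (2 : ℂ) •
        duhamel S (fun τ => mul (A₁ (v (projIcc 0 T hT τ))) (A₂ (Ψ (projIcc 0 T hT τ)))) t +
      duhamel S (fun τ => mul (A₂ (Ψ (projIcc 0 T hT τ))) (A₂ (Ψ (projIcc 0 T hT τ)))) t := by
  have hx : Continuous fun τ => A₁ (v (projIcc 0 T hT τ)) :=
    A₁.continuous.comp (v.continuous.comp continuous_projIcc)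
  have hy : Continuous fun τ => A₂ (Ψ (projIcc 0 T hT τ)) :=
    A₂.continuous.comp (Ψ.continuous.comp continuous_projIcc)
  have i₁ := intervalIntegrable_duhamel hγ hS hSc (continuous_mul_apply mul hx hx) ht0 ht1
  have i₂ := intervalIntegrable_duhamel hγ hS hSc (continuous_mul_apply mul hx hy) ht0 ht1
  have i₃ := intervalIntegrable_duhamel hγ hS hSc (continuous_mul_apply mul hy hy) ht0 ht1
  have i₂' : IntervalIntegrable (fun τ => (2 : ℂ) •
      S (t - τ) (mul (A₁ (v (projIcc 0 T hT τ))) (A₂ (Ψ (projIcc 0 T hT τ))))) volume 0 t :=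
    i₂.smul 2
  unfold duhamel
  beta_reduce
  rw [← intervalIntegral.integral_smul, ← intervalIntegral.integral_add i₁ i₂',
    ← intervalIntegral.integral_add (i₁.add i₂') i₃]
  congr 1
  funext τ
  unfold quadratic
  simp only [map_add, _root_.add_apply]
  rw [hmul (A₂ _) (A₁ _), two_smul]
  abel

theorem norm_mul_self_le (mul : Z →L[ℂ] Z →L[ℂ] Y) {z : Z} {b : ℝ} (hz : ‖z‖ ≤ b) :
    ‖mul z z‖ ≤ ‖mul‖ * b ^ 2 := by
  have hb : 0 ≤ b := (norm_nonneg _).trans hz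
  calc _ ≤ ‖mul‖ * ‖z‖ * ‖z‖ := mul.le_opNorm₂ z z
    _ ≤ ‖mul‖ * b * b := by gcongr
    _ = _ := by ring

theorem norm_mul_self_sub_le (mul : Z →L[ℂ] Z →L[ℂ] Y) {z₁ z₂ : Z} {b : ℝ} (h₁ : ‖z₁‖ ≤ b)
    (h₂ : ‖z₂‖ ≤ b) : ‖mul z₁ z₁ - mul z₂ z₂‖ ≤ 2 * ‖mul‖ * b * ‖z₁ - z₂‖ := by
  have e : mul z₁ z₁ - mul z₂ z₂ = mul (z₁ - z₂) z₁ + mul z₂ (z₁ - z₂) := by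
    simp only [map_sub, _root_.sub_apply]
    abel
  rw [e]
  calc _ ≤ ‖mul (z₁ - z₂) z₁‖ + ‖mul z₂ (z₁ - z₂)‖ := norm_add_le _ _
    _ ≤ ‖mul‖ * ‖z₁ - z₂‖ * ‖z₁‖ + ‖mul‖ * ‖z₂‖ * ‖z₁ - z₂‖ :=
        add_le_add (mul.le_opNorm₂ _ _) (mul.le_opNorm₂ _ _)
    _ ≤ ‖mul‖ * ‖z₁ - z₂‖ * b + ‖mul‖ * b * ‖z₁ - z₂‖ := by gcongr
    _ = _ := by ring

theorem norm_apply_add_apply_le (A₁ A₂ : W →L[ℂ] Z) {x y : W} {r s : ℝ} (hx : ‖x‖ ≤ r)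
    (hy : ‖y‖ ≤ s) : ‖A₁ x + A₂ y‖ ≤ (‖A₁‖ + ‖A₂‖) * (r + s) := by
  have hr : 0 ≤ r := (norm_nonneg _).trans hx
  have hs : 0 ≤ s := (norm_nonneg _).trans hy
  have h1 := A₁.le_opNorm_of_le hx
  have h2 := A₂.le_opNorm_of_le hy
  have h3 : 0 ≤ ‖A₁‖ * s := by positivity
  have h4 : 0 ≤ ‖A₂‖ * r := by positivity
  calc _ ≤ ‖A₁ x‖ + ‖A₂ y‖ := norm_add_le _ _
    _ ≤ _ := by linarith

theorem exists_pos_rpow_mul_le_half {θ : ℝ} (hθ : 0 < θ) {Q : ℝ} (hQ : 0 ≤ Q) :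
    ∃ T₀ : ℝ, 0 < T₀ ∧ T₀ ≤ 1 ∧ ∀ t, 0 ≤ t → t ≤ T₀ → t ^ θ * Q ≤ 1 / 2 := by
  -- Q + 1 instead of Q covers the case Q = 0.
  have h0 : 0 < (2 * (Q + 1))⁻¹ := by positivity
  refine ⟨min 1 ((2 * (Q + 1))⁻¹ ^ θ⁻¹), by positivity, min_le_left _ _, fun t ht htT => ?_⟩
  have h1 : t ^ θ ≤ (2 * (Q + 1))⁻¹ :=
    (Real.le_rpow_inv_iff_of_pos ht h0.le hθ).1 (htT.trans (min_le_right _ _))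
  calc _ ≤ (2 * (Q + 1))⁻¹ * Q := by gcongr
    _ ≤ 1 / 2 := by
      rw [inv_mul_le_iff₀ (by positivity)]
      linarith

/-- Local well-posedness of the abstract quadratic mild equation, with Lipschitz dependence on the
forcing. -/
theorem exists_time_wellPosed [CompleteSpace W] {S : ℝ → Y →L[ℂ] W} {C γ : ℝ} (hC : 0 ≤ C)
    (hγ : γ < 1) (hS : ∀ t, 0 < t → t ≤ 1 → ‖S t‖ ≤ C * t ^ (-γ))
    (hSc : ∀ y, ContinuousOn (fun t => S t y) (Ioi 0)) (mul : Z →L[ℂ] Z →L[ℂ] Y)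
    (A₁ A₂ : W →L[ℂ] Z) {a : ℝ → W} (ha : ContinuousOn a (Icc 0 1)) {r : ℝ}
    (har : ∀ t, 0 ≤ t → ‖a t‖ ≤ r) (M : ℝ) :
    ∃ T₀ : ℝ, 0 < T₀ ∧ T₀ ≤ 1 ∧ ∀ T (hT : 0 < T), T ≤ T₀ →
      (∀ Ψ : C(Icc (0 : ℝ) T, W), ‖Ψ‖ ≤ M → ∃! v : C(Icc (0 : ℝ) T, W),
        ∀ t : Icc (0 : ℝ) T, v t = a t + duhamel S (quadratic mul A₁ A₂ hT.le Ψ v) t) ∧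
      (∀ Ψ₁ Ψ₂ v₁ v₂ : C(Icc (0 : ℝ) T, W), ‖Ψ₁‖ ≤ M → ‖Ψ₂‖ ≤ M →
        (∀ t : Icc (0 : ℝ) T, v₁ t = a t + duhamel S (quadratic mul A₁ A₂ hT.le Ψ₁ v₁) t) →
        (∀ t : Icc (0 : ℝ) T, v₂ t = a t + duhamel S (quadratic mul A₁ A₂ hT.le Ψ₂ v₂) t) →
        ‖v₁ - v₂‖ ≤ ‖Ψ₁ - Ψ₂‖) := by
  have hr : 0 ≤ r := (norm_nonneg _).trans (har 0 le_rfl)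
  set R := r + 1 with hR
  set α := ‖A₁‖ + ‖A₂‖ with hα
  -- Bound for A₁v + A₂Ψ when v lies in the ball of radius R. The absolute value keeps b nonnegative
  -- even for negative M, where the conditions on Ψ cannot hold.
  set b := α * (R + |M|) with hb
  set K := C / (1 - γ) with hK
  have hα0 : 0 ≤ α := by positivity
  have hR0 : 0 ≤ R := by positivity
  have hb0 : 0 ≤ b := by positivity
  have hK0 : 0 ≤ K := div_nonneg hC (by linarith)
  -- Q adds the constants of the self-map bound and of the difference estimate, so one choice of T₀
  -- makes both at most 1/2.
  obtain ⟨T₀, hT₀, hT₀1, hQ⟩ := exists_pos_rpow_mul_le_half (θ := 1 - γ) (by linarith)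
    (Q := K * (‖mul‖ * b ^ 2) + K * (2 * ‖mul‖ * b * α)) (by positivity)
  refine ⟨T₀, hT₀, hT₀1, fun T hT hTT₀ => ?_⟩
  have hQ1 : ∀ t : ℝ, 0 ≤ t → t ≤ T → K * t ^ (1 - γ) * (‖mul‖ * b ^ 2) ≤ 1 / 2 := by
    intro t ht htT
    have h1 := hQ t ht (htT.trans hTT₀)
    have h2 : 0 ≤ t ^ (1 - γ) * (K * (2 * ‖mul‖ * b * α)) := by positivity
    linarith
  have hQ2 : ∀ t : ℝ, 0 ≤ t → t ≤ T → K * t ^ (1 - γ) * (2 * ‖mul‖ * b * α) ≤ 1 / 2 := by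
    intro t ht htT
    have h1 := hQ t ht (htT.trans hTT₀)
    have h2 : 0 ≤ t ^ (1 - γ) * (K * (‖mul‖ * b ^ 2)) := by positivity
    linarith
  have hT1 : T ≤ 1 := hTT₀.trans hT₀1
  have hMle : ∀ {Ψ : C(Icc (0 : ℝ) T, W)}, ‖Ψ‖ ≤ M → ∀ t, ‖Ψ t‖ ≤ |M| := fun h t =>
    (ContinuousMap.norm_coe_le_norm _ t).trans (h.trans (le_abs_self M))
  -- solutions stay in the ball of radius `R`
  have apriori : ∀ Ψ v : C(Icc (0 : ℝ) T, W), ‖Ψ‖ ≤ M →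
      (∀ t : Icc (0 : ℝ) T, v t = a t + duhamel S (quadratic mul A₁ A₂ hT.le Ψ v) t) →
      ∀ t, ‖v t‖ ≤ R := by
    intro Ψ v hΨ hv
    by_contra! hcon
    obtain ⟨t₁, ht₁⟩ := hcon
    -- Let t₂ be the first time with ‖v‖ ≥ R. Before it v is in the ball, so the Duhamel term at t₂
    -- is at most 1/2 and ‖v t₂‖ ≤ r + 1/2 < R, a contradiction.
    have hcl : IsCompact {t : Icc (0 : ℝ) T | R ≤ ‖v t‖} :=
      (isClosed_le continuous_const v.continuous.norm).isCompact
    obtain ⟨t₂, ht₂, hmin⟩ := hcl.exists_isLeast ⟨t₁, ht₁.le⟩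
    have hlt : ∀ τ : ℝ, 0 ≤ τ → τ < t₂ → ‖quadratic mul A₁ A₂ hT.le Ψ v τ‖ ≤ ‖mul‖ * b ^ 2 := by
      intro τ h0 h1
      refine norm_mul_self_le mul (norm_apply_add_apply_le A₁ A₂ ?_ (hMle hΨ _))
      by_contra! h2
      have h3 : t₂ ≤ projIcc 0 T hT.le τ := hmin h2.le
      have h4 : τ ∈ Icc 0 T := ⟨h0, h1.le.trans t₂.2.2⟩
      rw [projIcc_of_mem hT.le h4] at h3
      exact absurd h1 (not_lt.2 h3)
    have h1 := norm_duhamel_le hγ hS t₂.2.1 (t₂.2.2.trans hT1) hlt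
    have h2 : ‖v t₂‖ ≤ r + 1 / 2 := by
      rw [hv t₂]
      exact (norm_add_le _ _).trans
        (add_le_add (har _ t₂.2.1) (h1.trans (hQ1 _ t₂.2.1 t₂.2.2)))
    have h3 : R ≤ ‖v t₂‖ := ht₂
    linarith
  have diff : ∀ Ψ₁ Ψ₂ v₁ v₂ : C(Icc (0 : ℝ) T, W), ‖Ψ₁‖ ≤ M → ‖Ψ₂‖ ≤ M →
      (∀ t, ‖v₁ t‖ ≤ R) → (∀ t, ‖v₂ t‖ ≤ R) → ∀ t : Icc (0 : ℝ) T,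
      ‖duhamel S (quadratic mul A₁ A₂ hT.le Ψ₁ v₁) t -
        duhamel S (quadratic mul A₁ A₂ hT.le Ψ₂ v₂) t‖ ≤
        1 / 2 * (‖v₁ - v₂‖ + ‖Ψ₁ - Ψ₂‖) := by
    intro Ψ₁ Ψ₂ v₁ v₂ h₁ h₂ hv₁ hv₂ t
    rw [← duhamel_sub hγ hS hSc (continuous_quadratic ..) (continuous_quadratic ..) t.2.1
      (t.2.2.trans hT1)]
    have hN : ∀ τ : ℝ, ‖quadratic mul A₁ A₂ hT.le Ψ₁ v₁ τ - quadratic mul A₁ A₂ hT.le Ψ₂ v₂ τ‖ ≤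
        2 * ‖mul‖ * b * (α * (‖v₁ - v₂‖ + ‖Ψ₁ - Ψ₂‖)) := by
      intro τ
      refine (norm_mul_self_sub_le mul (norm_apply_add_apply_le A₁ A₂ (hv₁ _) (hMle h₁ _))
        (norm_apply_add_apply_le A₁ A₂ (hv₂ _) (hMle h₂ _))).trans ?_
      gcongr
      rw [add_sub_add_comm, ← map_sub, ← map_sub]
      exact norm_apply_add_apply_le A₁ A₂ (ContinuousMap.norm_coe_le_norm (v₁ - v₂) _)
        (ContinuousMap.norm_coe_le_norm (Ψ₁ - Ψ₂) _)
    refine (norm_duhamel_le hγ hS t.2.1 (t.2.2.trans hT1) fun τ _ _ => hN τ).trans ?_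
    calc _ = K * (t : ℝ) ^ (1 - γ) * (2 * ‖mul‖ * b * α) * (‖v₁ - v₂‖ + ‖Ψ₁ - Ψ₂‖) := by ring
      _ ≤ _ := by
        gcongr
        exact hQ2 t t.2.1 t.2.2
  have lip : ∀ Ψ₁ Ψ₂ v₁ v₂ : C(Icc (0 : ℝ) T, W), ‖Ψ₁‖ ≤ M → ‖Ψ₂‖ ≤ M →
      (∀ t : Icc (0 : ℝ) T, v₁ t = a t + duhamel S (quadratic mul A₁ A₂ hT.le Ψ₁ v₁) t) →
      (∀ t : Icc (0 : ℝ) T, v₂ t = a t + duhamel S (quadratic mul A₁ A₂ hT.le Ψ₂ v₂) t) →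
      ‖v₁ - v₂‖ ≤ ‖Ψ₁ - Ψ₂‖ := by
    intro Ψ₁ Ψ₂ v₁ v₂ h₁ h₂ hv₁ hv₂
    -- Absorbing half of ‖v₁ - v₂‖ on the left leaves Lipschitz constant 1.
    have h : ‖v₁ - v₂‖ ≤ 1 / 2 * (‖v₁ - v₂‖ + ‖Ψ₁ - Ψ₂‖) := by
      rw [ContinuousMap.norm_le _ (by positivity)]
      intro t
      rw [ContinuousMap.sub_apply, hv₁ t, hv₂ t, add_sub_add_left_eq_sub]
      exact diff Ψ₁ Ψ₂ v₁ v₂ h₁ h₂ (apriori Ψ₁ v₁ h₁ hv₁) (apriori Ψ₂ v₂ h₂ hv₂) t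
    linarith
  refine ⟨fun Ψ hΨ => ?_, lip⟩
  have hcont : ∀ v : C(Icc (0 : ℝ) T, W), Continuous fun t : Icc (0 : ℝ) T =>
      a t + duhamel S (quadratic mul A₁ A₂ hT.le Ψ v) t := by
    intro v
    have h1 : ContinuousOn (duhamel S (quadratic mul A₁ A₂ hT.le Ψ v)) (Icc 0 1) :=
      continuousOn_duhamel hγ hS hSc (continuous_quadratic ..)
        (B := ‖mul‖ * (α * (‖v‖ + ‖Ψ‖)) ^ 2) fun τ =>
        norm_mul_self_le mul (norm_apply_add_apply_le A₁ A₂ (ContinuousMap.norm_coe_le_norm _ _)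
          (ContinuousMap.norm_coe_le_norm _ _))
    exact ((ha.add h1).mono (Icc_subset_Icc_right hT1)).domRestrict
  set Φ : C(Icc (0 : ℝ) T, W) → C(Icc (0 : ℝ) T, W) := fun v => ⟨_, hcont v⟩
  have hball : ∀ {v : C(Icc (0 : ℝ) T, W)}, v ∈ Metric.closedBall (0 : C(Icc (0 : ℝ) T, W)) R →
      ∀ t, ‖v t‖ ≤ R := fun {v} hv t =>
    (ContinuousMap.norm_coe_le_norm _ t).trans (mem_closedBall_zero_iff.1 hv)
  have hmaps : MapsTo Φ (Metric.closedBall 0 R) (Metric.closedBall 0 R) := by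
    intro v hv
    rw [mem_closedBall_zero_iff, ContinuousMap.norm_le _ hR0]
    intro t
    have h1 := norm_duhamel_le hγ hS t.2.1 (t.2.2.trans hT1)
      (N := quadratic mul A₁ A₂ hT.le Ψ v) (b := ‖mul‖ * b ^ 2) fun τ _ _ =>
        norm_mul_self_le mul (norm_apply_add_apply_le A₁ A₂ (hball hv _) (hMle hΨ _))
    refine (norm_add_le _ _).trans ?_
    have h2 := har t t.2.1
    have h3 := hQ1 t t.2.1 t.2.2
    linarith
  have hcontr : ContractingWith (1 / 2) (hmaps.restrict Φ _ _) := by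
    refine ⟨by norm_num, LipschitzWith.of_dist_le_mul fun v₁ v₂ => ?_⟩
    rw [Subtype.dist_eq, Subtype.dist_eq, dist_eq_norm, dist_eq_norm,
      ContinuousMap.norm_le _ (by positivity)]
    intro t
    have h := diff Ψ Ψ v₁ v₂ hΨ hΨ (hball v₁.2) (hball v₂.2) t
    rw [sub_self, norm_zero, add_zero] at h
    refine le_trans (le_of_eq ?_) (h.trans (le_of_eq ?_))
    · congr 1
      exact add_sub_add_left_eq_sub _ _ _
    · norm_num
  have : CompleteSpace (Metric.closedBall (0 : C(Icc (0 : ℝ) T, W)) R) :=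
    Metric.isClosed_closedBall.completeSpace_coe
  have : Nonempty (Metric.closedBall (0 : C(Icc (0 : ℝ) T, W)) R) :=
    ⟨⟨0, Metric.mem_closedBall_self hR0⟩⟩
  have hfix := hcontr.fixedPoint_isFixedPt
  set v := ContractingWith.fixedPoint _ hcontr
  have hv : Φ v = v := congrArg Subtype.val hfix
  refine ⟨v, fun t => ?_, fun u hu => ?_⟩
  · conv_lhs => rw [← hv]
    rfl
  -- Uniqueness among all continuous solutions, not just those in the ball: the Lipschitz bound with
  -- equal forcings.
  · have := lip Ψ Ψ u v hΨ hΨ hu fun t => by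
      conv_lhs => rw [← hv]
      rfl
    rw [sub_self, norm_zero, norm_le_zero_iff, sub_eq_zero] at this
    exact this

end FixedPoint

end QuadraticHeat

end

/-! ### From the distributional equation to the fixed-point equation; choice of exponents -/

noncomputable section

namespace QuadraticHeat

open FourierTransform TemperedDistribution Filter Topology SobolevSpace

/-- Test against a bump function equal to 1 on a ball around the point. -/
theorem IsFunction.locallyIntegrable {d : ℕ} {f : 𝓢'(Sp d, ℂ)} {g : Sp d → ℂ}
    (h : IsFunction f g) : LocallyIntegrable g := by
  intro x
  let b : ContDiffBump x := ⟨1, 2, one_pos, one_lt_two⟩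
  have h₁ : HasCompactSupport (Complex.ofRealCLM ∘ b) := b.hasCompactSupport.comp_left rfl
  have h₂ : ContDiff ℝ ∞ (Complex.ofRealCLM ∘ b) :=
    Complex.ofRealCLM.contDiff.comp (b.contDiff (n := ⊤))
  refine ⟨Metric.closedBall x 1, Metric.closedBall_mem_nhds x one_pos, ?_⟩
  refine ((h (h₁.toSchwartzMap h₂)).1.integrableOn (s := Metric.closedBall x 1)).congr_fun
    (fun y hy => ?_) Metric.isClosed_closedBall.measurableSet
  have hb : b y = 1 := b.one_of_mem_closedBall hy
  simp [hb]

/-- The fundamental lemma of the calculus of variations. It makes the pointwise products independent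
of the representatives chosen in `IsMildSolution`. -/
theorem IsFunction.ae_eq {d : ℕ} {f : 𝓢'(Sp d, ℂ)} {g g' : Sp d → ℂ} (h : IsFunction f g)
    (h' : IsFunction f g') : g =ᵐ[volume] g' := by
  refine ae_eq_of_integral_contDiff_smul_eq h.locallyIntegrable h'.locallyIntegrable
    fun u hu huc => ?_
  have h₁ : HasCompactSupport (Complex.ofRealCLM ∘ u) := huc.comp_left rfl
  have h₂ : ContDiff ℝ ∞ (Complex.ofRealCLM ∘ u) := Complex.ofRealCLM.contDiff.comp hu
  simpa using (h (h₁.toSchwartzMap h₂)).2.symm.trans (h' (h₁.toSchwartzMap h₂)).2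

theorem IsFunction.congr {d : ℕ} {f : 𝓢'(Sp d, ℂ)} {g g' : Sp d → ℂ} (h : IsFunction f g)
    (hg : g =ᵐ[volume] g') : IsFunction f g' := by
  intro η
  have e : (fun x => η x * g x) =ᵐ[volume] fun x => η x * g' x := by
    filter_upwards [hg] with x hx
    rw [hx]
  exact ⟨(h η).1.congr e, (h η).2.trans (integral_congr_ae e)⟩

theorem IsFunction.distribution_eq {d : ℕ} {f f' : 𝓢'(Sp d, ℂ)} {g g' : Sp d → ℂ}
    (h : IsFunction f g) (h' : IsFunction f' g') (hg : g =ᵐ[volume] g') : f = f' := by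
  ext η
  rw [((h.congr hg) η).2, (h' η).2]

theorem IsDuhamel.eq_of_eqOn {d : ℕ} {N N' : ℝ → 𝓢'(Sp d, ℂ)} {t : ℝ} (ht : 0 ≤ t)
    {D D' : 𝓢'(Sp d, ℂ)} (h : IsDuhamel N t D) (h' : IsDuhamel N' t D')
    (hN : ∀ τ ∈ Icc 0 t, N τ = N' τ) : D = D' := by
  ext η
  rw [(h η).2, (h' η).2]
  refine intervalIntegral.integral_congr fun τ hτ => ?_
  rw [uIcc_of_le ht] at hτ
  simp only [hN τ hτ]

/-- The vector-valued Duhamel integral is an integral of tempered distributions. -/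
theorem isDuhamel_duhamel {d : ℕ} {β : ℝ} {m p q : ℝ≥0∞} [Fact (1 ≤ m)] [Fact (1 ≤ p)]
    [Fact (1 ≤ q)] {J : SobolevSpace d β p →L[ℂ] Lp ℂ q (volume : Measure (Sp d))}
    (hJ : ∀ v, lpEmbed d q (J v) = toDistribution v)
    {S : ℝ → Lp ℂ m (volume : Measure (Sp d)) →L[ℂ] SobolevSpace d β p}
    (hS : ∀ t, 0 < t → ∀ g, toDistribution (S t g) = heat d t (lpEmbed d m g))
    {N : ℝ → Lp ℂ m (volume : Measure (Sp d))} {t : ℝ} (ht : 0 ≤ t)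
    (hi : IntervalIntegrable (fun τ => S (t - τ) (N τ)) volume 0 t) :
    IsDuhamel (fun τ => lpEmbed d m (N τ)) t (toDistribution (duhamel S N t)) := by
  intro η
  -- Pairing with η is continuous on W^{β,p} because it factors through L^q, so it commutes with the
  -- Bochner integral.
  let L : SobolevSpace d β p →L[ℂ] ℂ :=
    PointwiseConvergenceCLM.evalCLM (RingHom.id ℂ) ℂ η ∘L lpEmbed d q ∘L J
  have hL : ∀ v, L v = toDistribution v η := fun v => by
    rw [← hJ v]
    rfl
  have e : ∀ᵐ τ ∂(volume : Measure ℝ), τ ∈ uIoc 0 t →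
      L (S (t - τ) (N τ)) = heat d (t - τ) (lpEmbed d m (N τ)) η := by
    -- S is identified with the heat flow only at positive times, so the endpoint τ = t is
    -- discarded.
    have h1 : ∀ᵐ τ : ℝ ∂volume, τ ≠ t := by simp [ae_iff]
    filter_upwards [h1] with τ hτ hτ'
    rw [uIoc_of_le ht] at hτ'
    rw [hL, hS _ (sub_pos.2 (lt_of_le_of_ne hτ'.2 hτ))]
  constructor
  · refine IntervalIntegrable.congr_ae (f := fun τ => L (S (t - τ) (N τ))) ?_
      ((ae_restrict_iff' measurableSet_uIoc).2 e)
    exact ⟨L.integrable_comp hi.1, L.integrable_comp hi.2⟩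
  · rw [← hL, duhamel, ← L.intervalIntegral_comp_comm hi]
    exact intervalIntegral.integral_congr_ae e

section Products

variable {d : ℕ} {q m : ℝ≥0∞} [Fact (1 ≤ q)] [Fact (1 ≤ m)] [ENNReal.HolderTriple q q m]

/-- The pointwise product `L^q × L^q → L^m`, `1/m = 2/q`. -/
def lpMul (d : ℕ) (q m : ℝ≥0∞) [Fact (1 ≤ q)] [Fact (1 ≤ m)] [ENNReal.HolderTriple q q m] :
    Lp ℂ q (volume : Measure (Sp d)) →L[ℂ] Lp ℂ q (volume : Measure (Sp d)) →L[ℂ]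
      Lp ℂ m (volume : Measure (Sp d)) :=
  (ContinuousLinearMap.mul ℂ ℂ).holderL volume q q m

theorem coeFn_lpMul (f g : Lp ℂ q (volume : Measure (Sp d))) :
    lpMul d q m f g =ᵐ[volume] fun x => f x * g x :=
  (ContinuousLinearMap.mul ℂ ℂ).coeFn_holder f g

theorem lpMul_comm (f g : Lp ℂ q (volume : Measure (Sp d))) :
    lpMul d q m f g = lpMul d q m g f := by
  apply Lp.ext
  filter_upwards [coeFn_lpMul (m := m) f g, coeFn_lpMul (m := m) g f] with x h1 h2
  rw [h1, h2, mul_comm]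

/-- Multiplication by a continuous compactly supported function on `L^q`. -/
theorem exists_clm_mul_of_hasCompactSupport {ρ : Sp d → ℝ} (hρ : Continuous ρ)
    (hρc : HasCompactSupport ρ) :
    ∃ R : Lp ℂ q (volume : Measure (Sp d)) →L[ℂ] Lp ℂ q (volume : Measure (Sp d)),
      ∀ f, R f =ᵐ[volume] fun x => (ρ x : ℂ) * f x := by
  have hm : MemLp (fun x => (ρ x : ℂ)) ⊤ (volume : Measure (Sp d)) :=
    (Complex.continuous_ofReal.comp hρ).memLp_top_of_hasCompactSupport
      (hρc.comp_left Complex.ofReal_zero) volume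
  refine ⟨(ContinuousLinearMap.mul ℂ ℂ).holderL volume ⊤ q q (hm.toLp _), fun f => ?_⟩
  filter_upwards [(ContinuousLinearMap.mul ℂ ℂ).coeFn_holder (r := q) (hm.toLp _) f,
    hm.coeFn_toLp] with x h1 h2
  rw [ContinuousLinearMap.holderL_apply_apply, h1, h2]
  rfl

end Products

/-- The mild equation as a fixed-point equation in `W^{β,p}`. -/
theorem isMildSolution_iff {d : ℕ} {β : ℝ} {m p q : ℝ≥0∞} [Fact (1 ≤ m)] [Fact (1 ≤ p)]
    [Fact (1 ≤ q)] [ENNReal.HolderTriple q q m]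
    {J : SobolevSpace d β p →L[ℂ] Lp ℂ q (volume : Measure (Sp d))}
    (hJ : ∀ v, lpEmbed d q (J v) = toDistribution v) {ρ : Sp d → ℝ}
    {R : Lp ℂ q (volume : Measure (Sp d)) →L[ℂ] Lp ℂ q (volume : Measure (Sp d))}
    (hR : ∀ f, R f =ᵐ[volume] fun x => (ρ x : ℂ) * f x)
    {U : ℝ → SobolevSpace d β p →L[ℂ] SobolevSpace d β p}
    (hU : ∀ t, 0 ≤ t → ∀ v, toDistribution (U t v) = heat d t (toDistribution v))
    {S : ℝ → Lp ℂ m (volume : Measure (Sp d)) →L[ℂ] SobolevSpace d β p}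
    (hS : ∀ t, 0 < t → ∀ g, toDistribution (S t g) = heat d t (lpEmbed d m g)) {C γ : ℝ}
    (hγ : γ < 1) (hSn : ∀ t, 0 < t → t ≤ 1 → ‖S t‖ ≤ C * t ^ (-γ))
    (hSc : ∀ y, ContinuousOn (fun t => S t y) (Ioi 0)) {T : ℝ} (hT : 0 ≤ T) (hT1 : T ≤ 1)
    (φ : SobolevSpace d β p) (Ψ v : X d β p T) :
    IsMildSolution ρ φ Ψ v ↔
      ∀ t : Icc (0 : ℝ) T, v t = U t φ + duhamel S (quadratic (lpMul d q m) (R ∘L J) J hT Ψ v) t := by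
  set x : ℝ → Lp ℂ q (volume : Measure (Sp d)) := fun τ => R (J (v (projIcc 0 T hT τ))) with hx
  set y : ℝ → Lp ℂ q (volume : Measure (Sp d)) := fun τ => J (Ψ (projIcc 0 T hT τ)) with hy
  have hxc : Continuous x :=
    R.continuous.comp (J.continuous.comp (v.continuous.comp continuous_projIcc))
  have hyc : Continuous y := J.continuous.comp (Ψ.continuous.comp continuous_projIcc)
  obtain ⟨B₁, hB₁⟩ : ∃ B : ℝ → Lp ℂ m (volume : Measure (Sp d)), B = fun τ => lpMul d q m (x τ) (x τ) := ⟨_, rfl⟩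
  obtain ⟨B₂, hB₂⟩ : ∃ B : ℝ → Lp ℂ m (volume : Measure (Sp d)), B = fun τ => lpMul d q m (x τ) (y τ) := ⟨_, rfl⟩
  obtain ⟨B₃, hB₃⟩ : ∃ B : ℝ → Lp ℂ m (volume : Measure (Sp d)), B = fun τ => lpMul d q m (y τ) (y τ) := ⟨_, rfl⟩
  have hB₁c : Continuous B₁ := by
    rw [hB₁]
    exact continuous_mul_apply _ hxc hxc
  have hB₂c : Continuous B₂ := by
    rw [hB₂]
    exact continuous_mul_apply _ hxc hyc
  have hB₃c : Continuous B₃ := by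
    rw [hB₃]
    exact continuous_mul_apply _ hyc hyc
  have hii : ∀ {N : ℝ → Lp ℂ m (volume : Measure (Sp d))}, Continuous N → ∀ t : Icc (0 : ℝ) T,
      IntervalIntegrable (fun τ => S (t - τ) (N τ)) volume 0 t := fun hN t =>
    intervalIntegrable_duhamel hγ hSn hSc hN t.2.1 (t.2.2.trans hT1)
  have hsum : ∀ t : Icc (0 : ℝ) T, duhamel S (quadratic (lpMul d q m) (R ∘L J) J hT Ψ v) t =
      duhamel S B₁ t + (2 : ℂ) • duhamel S B₂ t + duhamel S B₃ t := by
    intro t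
    rw [hB₁, hB₂, hB₃]
    exact duhamel_quadratic hγ hSn hSc lpMul_comm (R ∘L J) J hT Ψ v t.2.1 (t.2.2.trans hT1)
  have hD : ∀ {N : ℝ → Lp ℂ m (volume : Measure (Sp d))}, Continuous N → ∀ t : Icc (0 : ℝ) T,
      IsDuhamel (fun τ => lpEmbed d m (N τ)) t (toDistribution (duhamel S N t)) := fun hN t =>
    isDuhamel_duhamel hJ hS t.2.1 (hii hN t)
  have hvJ : ∀ u : SobolevSpace d β p, IsFunction (toDistribution u) (J u) := fun u => by
    rw [← hJ u]
    exact lpEmbed_isFunction _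
  have f₁ : ∀ τ, IsFunction (lpEmbed d m (B₁ τ))
      (fun z => (ρ z : ℂ) ^ 2 * J (v (projIcc 0 T hT τ)) z ^ 2) := by
    intro τ
    rw [hB₁]
    refine (lpEmbed_isFunction _).congr ?_
    filter_upwards [coeFn_lpMul (m := m) (x τ) (x τ), hR (J (v (projIcc 0 T hT τ)))] with z h1 h2
    rw [h1]
    simp only [hx, h2]
    ring
  have f₂ : ∀ τ, IsFunction (lpEmbed d m (B₂ τ))
      (fun z => (ρ z : ℂ) * J (v (projIcc 0 T hT τ)) z * J (Ψ (projIcc 0 T hT τ)) z) := by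
    intro τ
    rw [hB₂]
    refine (lpEmbed_isFunction _).congr ?_
    filter_upwards [coeFn_lpMul (m := m) (x τ) (y τ), hR (J (v (projIcc 0 T hT τ)))] with z h1 h2
    rw [h1]
    simp only [hx, hy, h2]
  have f₃ : ∀ τ, IsFunction (lpEmbed d m (B₃ τ)) (fun z => J (Ψ (projIcc 0 T hT τ)) z ^ 2) := by
    intro τ
    rw [hB₃]
    refine (lpEmbed_isFunction _).congr ?_
    filter_upwards [coeFn_lpMul (m := m) (y τ) (y τ)] with z h1
    rw [h1, sq]
  constructor
  · rintro ⟨w, ψ, N₁, N₂, N₃, hf, hsol⟩ t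
    -- The existential data of a mild solution are forced on [0,t]: w and ψ agree almost everywhere
    -- with J v and J Ψ, which determines the three product distributions.
    have key : ∀ τ ∈ Icc (0 : ℝ) t, N₁ τ = lpEmbed d m (B₁ τ) ∧ N₂ τ = lpEmbed d m (B₂ τ) ∧
        N₃ τ = lpEmbed d m (B₃ τ) := by
      intro τ hτ
      have hτT : τ ∈ Icc (0 : ℝ) T := ⟨hτ.1, hτ.2.trans t.2.2⟩
      obtain ⟨hw, hψ, h₁, h₂, h₃⟩ := hf ⟨τ, hτT⟩
      have f₁' := f₁ τ
      have f₂' := f₂ τ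
      have f₃' := f₃ τ
      rw [projIcc_of_mem hT hτT] at f₁' f₂' f₃'
      have ew := hw.ae_eq (hvJ _)
      have eψ := hψ.ae_eq (hvJ _)
      refine ⟨h₁.distribution_eq f₁' ?_, h₂.distribution_eq f₂' ?_, h₃.distribution_eq f₃' ?_⟩
      · filter_upwards [ew] with z hz
        rw [hz]
      · filter_upwards [ew, eψ] with z hz hz'
        rw [hz, hz']
      · filter_upwards [eψ] with z hz
        rw [hz]
    obtain ⟨D₁, D₂, D₃, h₁, h₂, h₃, h⟩ := hsol t
    apply toDistribution_injective
    rw [h, hsum, map_add, map_add, map_add, map_smul, hU t t.2.1,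
      h₁.eq_of_eqOn t.2.1 (hD hB₁c t) fun τ hτ => (key τ hτ).1,
      h₂.eq_of_eqOn t.2.1 (hD hB₂c t) fun τ hτ => (key τ hτ).2.1,
      h₃.eq_of_eqOn t.2.1 (hD hB₃c t) fun τ hτ => (key τ hτ).2.2]
    abel
  · intro h
    -- Conversely the L^q representatives serve as data; the constant extension outside [0,T] plays
    -- no role.
    refine ⟨fun τ => J (v (projIcc 0 T hT τ)), fun τ => J (Ψ (projIcc 0 T hT τ)),
      fun τ => lpEmbed d m (B₁ τ), fun τ => lpEmbed d m (B₂ τ), fun τ => lpEmbed d m (B₃ τ),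
      fun τ => ⟨?_, ?_, f₁ τ, f₂ τ, f₃ τ⟩, fun t => ⟨_, _, _, hD hB₁c t, hD hB₂c t, hD hB₃c t, ?_⟩⟩
    · beta_reduce
      rw [projIcc_of_mem hT τ.2]
      exact hvJ _
    · beta_reduce
      rw [projIcc_of_mem hT τ.2]
      exact hvJ _
    · rw [h t, hsum, map_add, map_add, map_add, map_smul, hU t t.2.1]
      abel

/-- The choice of the integrability exponent `1/x`. -/
theorem exists_exponent {d : ℕ} (hd : 1 ≤ d) {β P : ℝ} (hβ0 : 0 < β) (hβ1 : β < 1) (hP : 2 ≤ P)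
    (h : (d : ℝ) / (2 * P) < 1 + β / 2) :
    ∃ x : ℝ, 0 < x ∧ 2 * x ≤ 1 ∧ x ≤ 1 / P ∧ 1 / P ≤ 2 * x ∧ d * (1 / P - x) < β ∧
      β / 2 + d / 2 * (2 * x - 1 / P) < 1 := by
  have hd0 : (0 : ℝ) < d := by exact_mod_cast hd
  have hP0 : 0 < 1 / P := by positivity
  have hP2 : 1 / P ≤ 1 / 2 := one_div_le_one_div_of_le two_pos hP
  have h' : d / 2 * (1 / P) < 1 + β / 2 := by
    refine lt_of_eq_of_lt ?_ h
    field_simp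
  -- The lower bounds express m ≤ p and the Sobolev embedding, the upper bounds q ≥ p and γ < 1. The
  -- condition 2x ≤ 1 follows from x < 1/P ≤ 1/2.
  set lo := max (1 / (2 * P)) (1 / P - β / d) with hlo
  set hi := min (1 / P) ((1 - β / 2) / d + 1 / (2 * P)) with hhi
  have e : 1 / (2 * P) = 1 / P / 2 := by field_simp
  have hβd : 0 < β / d := by positivity
  have hlohi : lo < hi := by
    refine max_lt (lt_min ?_ ?_) (lt_min ?_ ?_)
    · rw [e]; linarith
    · have : 0 < (1 - β / 2) / d := div_pos (by linarith) hd0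
      linarith
    · linarith
    -- The only comparison that needs d/(2P) < 1 + β/2: Sobolev lower bound against smoothing upper
    -- bound.
    · rw [e]
      have h1 : 1 / P / 2 < (1 + β / 2) / d := by
        rw [lt_div_iff₀ hd0]
        linarith
      have h2 : (1 + β / 2) / d = (1 - β / 2) / d + β / d := by ring
      linarith
  obtain ⟨x, hx1, hx2⟩ := exists_between hlohi
  have a1 : 1 / (2 * P) < x := (le_max_left _ _).trans_lt hx1
  have a2 : 1 / P - β / d < x := (le_max_right _ _).trans_lt hx1
  have a3 : x < 1 / P := hx2.trans_le (min_le_left _ _)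
  have a4 : x < (1 - β / 2) / d + 1 / (2 * P) := hx2.trans_le (min_le_right _ _)
  rw [e] at a1 a4
  refine ⟨x, by linarith, by linarith, a3.le, by linarith, ?_, ?_⟩
  · have : 1 / P - x < β / d := by linarith
    rw [lt_div_iff₀ hd0] at this
    linarith
  · have : x - 1 / P / 2 < (1 - β / 2) / d := by linarith
    rw [lt_div_iff₀ hd0] at this
    linarith

end QuadraticHeat

end

/-! ### Assembly with the concrete exponents and operators -/

theorem mainTheorem10 (d : ℕ) (hd : 1 ≤ d) (ρ : QuadraticHeat.Sp d → ℝ)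
    (hρ : ContDiff ℝ ∞ ρ) (hρc : HasCompactSupport ρ)
    (β : ℝ) (hβ0 : 0 < β) (hβ1 : β < 1)
    (p : ℝ≥0∞) [Fact (1 ≤ p)] (hp2 : 2 ≤ p) (hp : p ≠ ⊤)
    (hdp : (d : ℝ) / (2 * p.toReal) < 1 + β / 2)
    (φ : QuadraticHeat.SobolevSpace d β p) (M : ℝ) :
    ∃ T₀ : ℝ, 0 < T₀ ∧ ∃ L : ℝ, 0 ≤ L ∧ ∀ T : ℝ, 0 < T → T ≤ T₀ →
      (∀ Ψ : QuadraticHeat.X d β p T, ‖Ψ‖ ≤ M →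
        ∃! v : QuadraticHeat.X d β p T, QuadraticHeat.IsMildSolution ρ φ Ψ v) ∧
      (∀ Ψ₁ Ψ₂ v₁ v₂ : QuadraticHeat.X d β p T, ‖Ψ₁‖ ≤ M → ‖Ψ₂‖ ≤ M →
        QuadraticHeat.IsMildSolution ρ φ Ψ₁ v₁ → QuadraticHeat.IsMildSolution ρ φ Ψ₂ v₂ →
        ‖v₁ - v₂‖ ≤ L * ‖Ψ₁ - Ψ₂‖) := by
  open QuadraticHeat in
  have hP : 2 ≤ p.toReal := by
    have := ENNReal.toReal_mono hp hp2
    simpa using this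
  obtain ⟨x, hx0, hx2, hxP, hPx, hsob, hexp⟩ := exists_exponent hd hβ0 hβ1 hP hdp
  -- Here x = 1/q and 1/m = 2x, so Hölder maps L^q × L^q to L^m.
  set q : ℝ≥0∞ := ENNReal.ofReal x⁻¹ with hq
  set m : ℝ≥0∞ := ENNReal.ofReal (2 * x)⁻¹ with hm
  have hqr : q.toReal = x⁻¹ := ENNReal.toReal_ofReal (by positivity)
  have hmr : m.toReal = (2 * x)⁻¹ := ENNReal.toReal_ofReal (by positivity)
  have hm1 : 1 ≤ (2 * x)⁻¹ := (one_le_inv₀ (by positivity)).2 hx2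
  have : Fact (1 ≤ m) := ⟨ENNReal.one_le_ofReal.2 hm1⟩
  have : Fact (1 ≤ q) := ⟨ENNReal.one_le_ofReal.2 ((one_le_inv₀ hx0).2 (by linarith))⟩
  have : ENNReal.HolderTriple q q m := ⟨by
    rw [hq, hm, ENNReal.ofReal_inv_of_pos hx0, ENNReal.ofReal_inv_of_pos (by positivity), inv_inv,
      inv_inv, ← ENNReal.ofReal_add hx0.le hx0.le, two_mul]⟩
  have hpq : p.toReal ≤ q.toReal := by
    rw [hqr]
    exact (le_inv_comm₀ (by linarith) hx0).2 (by rwa [← one_div])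
  have hmp : m.toReal ≤ p.toReal := by
    rw [hmr]
    exact (inv_le_comm₀ (by positivity) (by linarith)).2 (by rwa [← one_div])
  obtain ⟨J, hJ⟩ := exists_clm_sobolev_lp d hp (q := q) ENNReal.ofReal_ne_top hpq hβ0
    (by rwa [hqr, one_div x⁻¹, inv_inv])
  obtain ⟨R, hR⟩ := exists_clm_mul_of_hasCompactSupport (q := q) hρ.continuous hρc
  obtain ⟨U, hU, hUn, hUc⟩ := exists_heat_sobolev d β hp
  obtain ⟨C, hC, S, hS, hSn, hSc⟩ := exists_heat_lp_sobolev d (m := m) ENNReal.ofReal_ne_top hp hmp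
    hβ0 (by linarith)
  have hγ : β / 2 + d / 2 * (1 / m.toReal - 1 / p.toReal) < 1 := by
    rwa [hmr, one_div (2 * x)⁻¹, inv_inv]
  -- The free evolution is bounded by ‖φ‖ because the semigroup is contractive on W^{β,p}. The
  -- weight ρ enters only through A₁ = R ∘ J, while A₂ = J.
  obtain ⟨T₀, hT₀, hT₀1, h⟩ := exists_time_wellPosed hC hγ hSn hSc (lpMul d q m) (R ∘L J) J
    (a := fun t => U t φ) ((hUc φ).mono Set.Icc_subset_Ici_self) (r := ‖φ‖)
    (fun t ht => by simpa using (U t).le_of_opNorm_le (hUn t ht) φ) M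
  refine ⟨T₀, hT₀, 1, zero_le_one, fun T hT hTT₀ => ?_⟩
  have hiff := isMildSolution_iff hJ hR hU hS hγ hSn hSc hT.le (hTT₀.trans hT₀1) φ
  simp only [hiff, one_mul]
  exact h T hT hTT₀
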